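/- Let $\mathsf X$ be a measurable space with countably generated $\sigma$-field, $\Theta\subseteq\mathbb R^d$, $\theta_0\in\Theta$, and let $P(\theta)$, $\theta\in\Theta$, be Markov transition kernels on $\mathsf X$. Let $e_i$ be the $i$-th unit vector and suppose $\theta_0+he_i\in\Theta$ for all sufficiently small $|h|$ and each $i$. For $\epsilon>0$ put $B_\epsilon(\theta_0)=\{\theta\in\Theta:\max_i|\theta_i-\theta_{0,i}|<\epsilon\}$. For $w:\mathsf X\to[1,\infty)$ put $|g|_w=\sup_x|g(x)|/w(x)$, and for a signed kernel $Q$ put $|||Q|||_V=\sup\{|Qu|_V: u \text{ measurable},\ |u|_V=1\}$, where $Qu(x)=\int u(y)\,Q(x,dy)$. A function of $\theta$ is called differentiable at $\theta_0$ if all its partial derivatives $\partial_i=\partial/\partial\theta_i$, $1\le i\le d$, exist at $\theta_0$; its gradient $\nabla$ is then the vector of these. Assume that for some $\epsilon>0$: (i) $P(\theta)$ is $\psi$-irreducible for every $\theta\in B_\epsilon(\theta_0)$, i.e. there is a nonzero $\sigma$-finite measure $\psi$ such that $\psi(A)>0$ implies that for every $x$ there is an $n$ with $P^n(\theta,x,A)>0$;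 (ii) for $\theta\in B_\epsilon(\theta_0)$ there are nonnegative, jointly measurable densities $p(\theta,x,y)$ with $P(\theta,x,dy)=p(\theta,x,y)P(\theta_0,x,dy)$, and for all $x,y$ the map $\theta\mapsto p(\theta,x,y)$ is differentiable at $\theta_0$; (iii) there are a measurable set $K$, $\delta>0$, $m\ge1$ and a probability measure $\nu$ with $P^m(\theta,x,\cdot)\ge\delta\nu$ for all $x\in K$, $\theta\in B_\epsilon(\theta_0)$; (iv) there are a measurable $V:\mathsf X\to[1,\infty)$ and constants $0<\lambda<1$, $b<\infty$ with $P(\theta)V(x)\le\lambda V(x)+b1_K(x)$ for all $x\in\mathsf X$, $\theta\in B_\epsilon(\theta_0)$; (v) with $P^{(i)}(\theta_0,x,dy)=\partial_i p(\theta_0,x,y)P(\theta_0,x,dy)$ (where $V\,\partial_ip(\theta_0,x,\cdot)$ is $P(\theta_0,x,\cdot)$-integrable for each $x$), $|||P^{(i)}(\theta_0)|||_V<\infty$ and $\lim_{h\to0}\big|\big|\big|\tfrac{P(\theta_0+he_i)-P(\theta_0)}{h}-P^{(i)}(\theta_0)\big|\big|\big|_V=0$ for each $1\le i\le d$; (vi)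 $|g_{ii}|_V<\infty$ for each $1\le i\le d$, where $g_{ii}(x)=\int(\partial_ip(\theta_0,x,y))^2P(\theta_0,x,dy)$; (vii) $f:\mathsf X\to\mathbb R$ is measurable and $|f|_{\sqrt V}<\infty$. Let $\Phi=(\Phi_k)_{k\ge0}$ be a Markov chain with transition kernel $P(\theta_0)$ and initial distribution $\mu$ with $\int V\,d\mu<\infty$, let $E_{\theta_0}$ denote the corresponding expectation, and put $\alpha_n=\frac1n\sum_{j=0}^{n-1}f(\Phi_j)$, $L_n(\theta)=\prod_{j=1}^np(\theta,\Phi_{j-1},\Phi_j)$. Then for every $\theta\in B_\epsilon(\theta_0)$ the kernel $P(\theta)$ has a unique invariant probability measure $\pi(\theta)$, and $f$ is $\pi(\theta)$-integrable; the function $\alpha(\theta)=\int f\,d\pi(\theta)$ is differentiable at $\theta_0$; each $\alpha_n\nabla L_n(\theta_0)$ is integrable; and $$E_{\theta_0}\left[\alpha_n\nabla L_n(\theta_0)\right]\longrightarrow\nabla\alpha(\theta_0)\qquad(n\to\infty).$$ -/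

import Mathlib

open MeasureTheory ProbabilityTheory Filter Topology
open scoped ENNReal

namespace LRGradient

noncomputable section

/-- The weighted supremum norm `sup_x |g x| / w x` of a function given through its absolute value
`|g| : X → [0, ∞]`; the supremum is taken in `[0, ∞]`. -/
def wnorm {X : Type*} (w : X → ℝ) (absg : X → ℝ≥0∞) : ℝ≥0∞ :=
  ⨆ x, absg x / ENNReal.ofReal (w x)

/-- The `V`-operator norm of an operator `T` on functions: the supremum in `[0, ∞]` of `|T u|_V`
over the measurable functions `u` with `|u|_V = 1`. -/
def opNorm {X : Type*} [MeasurableSpace X] (V : X → ℝ) (T : (X → ℝ) → X → ℝ) : ℝ≥0∞ :=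
  ⨆ u : {u : X → ℝ // Measurable u ∧ wnorm V (fun x => ‖u x‖ₑ) = 1},
    wnorm V (fun x => ‖T u.1 x‖ₑ)

/-- The `i`-th partial derivative at `θ` of a function on `ℝ^d`. -/
def partialDeriv {d : ℕ} (i : Fin d) (F : (Fin d → ℝ) → ℝ) (θ : Fin d → ℝ) : ℝ :=
  lineDeriv ℝ F θ (Pi.single i 1)

/-- All partial derivatives of `F` exist at `θ`. -/
def HasGradientAt {d : ℕ} (F : (Fin d → ℝ) → ℝ) (θ : Fin d → ℝ) : Prop :=
  ∀ i : Fin d, LineDifferentiableAt ℝ F θ (Pi.single i 1)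

/-- The gradient, the vector of the partial derivatives. -/
def grad {d : ℕ} (F : (Fin d → ℝ) → ℝ) (θ : Fin d → ℝ) : Fin d → ℝ :=
  fun i => partialDeriv i F θ

/-- The points of the parameter set `Θ` at sup-distance less than `ε` from `θ₀`. -/
def box {d : ℕ} (Θ : Set (Fin d → ℝ)) (θ₀ : Fin d → ℝ) (ε : ℝ) : Set (Fin d → ℝ) :=
  {θ | θ ∈ Θ ∧ ∀ i, |θ i - θ₀ i| < ε}

/-- `ψ`-irreducibility: some nonzero σ-finite measure is an irreducibility measure. -/
def IsPsiIrreducible {X : Type*} [MeasurableSpace X] (κ : Kernel X X) : Prop :=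
  ∃ ψ : Measure X, SigmaFinite ψ ∧ ψ ≠ 0 ∧ Kernel.IsIrreducible ψ κ

/-- Stationary distributions: invariant probability measures. -/
def IsStationary {X : Type*} [MeasurableSpace X] (κ : Kernel X X) (π : Measure X) : Prop :=
  IsProbabilityMeasure π ∧ Kernel.Invariant κ π

open Classical in
/-- The stationary distribution of `κ`; meaningful if there is exactly one. -/
def stationary {X : Type*} [MeasurableSpace X] (κ : Kernel X X) : Measure X :=
  if h : ∃ π, IsStationary κ π then h.choose else 0

/-- The steady-state expectation `α(θ) = π(θ) f`. -/
def steadyState {X : Type*} [MeasurableSpace X] {d : ℕ} (P : (Fin d → ℝ) → Kernel X X)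
    (f : X → ℝ) (θ : Fin d → ℝ) : ℝ :=
  ∫ x, f x ∂(stationary (P θ))

/-- The signed kernel `P^(i)(θ₀, x, dy) = ∂_i p(θ₀, x, y) P(θ₀, x, dy)`, acting on functions. -/
def derivKernel {X : Type*} [MeasurableSpace X] {d : ℕ} (P : (Fin d → ℝ) → Kernel X X)
    (p : (Fin d → ℝ) → X → X → ℝ) (θ₀ : Fin d → ℝ) (i : Fin d) (u : X → ℝ) (x : X) : ℝ :=
  ∫ y, u y * partialDeriv i (fun θ => p θ x y) θ₀ ∂(P θ₀ x)

/-- The difference quotient `(P(θ₀ + h e_i) - P(θ₀)) / h`, acting on functions. -/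
def diffQuot {X : Type*} [MeasurableSpace X] {d : ℕ} (P : (Fin d → ℝ) → Kernel X X)
    (θ₀ : Fin d → ℝ) (i : Fin d) (h : ℝ) (u : X → ℝ) (x : X) : ℝ :=
  ((∫ y, u y ∂(P (θ₀ + h • Pi.single i 1) x)) - ∫ y, u y ∂(P θ₀ x)) / h

/-- The standing assumption on the parametrized family of transition kernels `P`, the densities
`p`, the small set `K` with its constants `δ`, `m` and measure `ν`, the Lyapunov function `V` with
its constants `lam`, `b`, and the cost function `f`. -/
structure StandingAssumption {X : Type*} [MeasurableSpace X] {d : ℕ}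
    (Θ : Set (Fin d → ℝ)) (P : (Fin d → ℝ) → Kernel X X) (p : (Fin d → ℝ) → X → X → ℝ)
    (θ₀ : Fin d → ℝ) (ε : ℝ) (K : Set X) (δ : ℝ) (m : ℕ) (ν : Measure X)
    (V : X → ℝ) (lam b : ℝ) (f : X → ℝ) : Prop where
  eps_pos : 0 < ε
  /-- each `P θ` with `θ ∈ Θ` is a transition kernel -/
  markov : ∀ θ ∈ Θ, IsMarkovKernel (P θ)
  mem : θ₀ ∈ Θ
  /-- the parameters `θ₀ + h e_i` are admissible for all small `h` -/
  axes : ∀ i : Fin d, ∀ᶠ h : ℝ in 𝓝 0, θ₀ + h • Pi.single i 1 ∈ Θ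
  irreducible : ∀ θ ∈ box Θ θ₀ ε, IsPsiIrreducible (P θ)
  density_measurable : ∀ θ ∈ box Θ θ₀ ε, Measurable (Function.uncurry (p θ))
  density_nonneg : ∀ θ ∈ box Θ θ₀ ε, ∀ x y, 0 ≤ p θ x y
  density : ∀ θ ∈ box Θ θ₀ ε, ∀ x,
    P θ x = (P θ₀ x).withDensity (fun y => ENNReal.ofReal (p θ x y))
  density_differentiable : ∀ x y, HasGradientAt (fun θ => p θ x y) θ₀
  small_measurable : MeasurableSet K
  delta_pos : 0 < δ
  one_le_m : 1 ≤ m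
  prob : IsProbabilityMeasure ν
  small : ∀ θ ∈ box Θ θ₀ ε, ∀ x ∈ K, ENNReal.ofReal δ • ν ≤ (P θ ^ m) x
  V_measurable : Measurable V
  one_le_V : ∀ x, 1 ≤ V x
  lam_pos : 0 < lam
  lam_lt_one : lam < 1
  drift : ∀ θ ∈ box Θ θ₀ ε, ∀ x,
    ∫⁻ y, ENNReal.ofReal (V y) ∂(P θ x) ≤ ENNReal.ofReal (lam * V x + K.indicator (fun _ => b) x)
  /-- the signed measures `P^(i)(θ₀, x, ·)` act on all functions bounded by a multiple of `V` -/
  deriv_integrable : ∀ i : Fin d, ∀ x,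
    Integrable (fun y => V y * partialDeriv i (fun θ => p θ x y) θ₀) (P θ₀ x)
  deriv_bounded : ∀ i : Fin d, opNorm V (derivKernel P p θ₀ i) < ∞
  deriv_limit : ∀ i : Fin d, Tendsto
    (fun h : ℝ => opNorm V (fun u x => diffQuot P θ₀ i h u x - derivKernel P p θ₀ i u x))
    (𝓝[≠] 0) (𝓝 0)
  /-- `|g_ii|_V < ∞` -/
  fisher_bounded : ∀ i : Fin d, wnorm V (fun x =>
    ∫⁻ y, ENNReal.ofReal ((partialDeriv i (fun θ => p θ x y) θ₀) ^ 2) ∂(P θ₀ x)) < ∞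
  f_measurable : Measurable f
  f_bounded : wnorm (fun x => √(V x)) (fun x => ‖f x‖ₑ) < ∞

/-- Under `Pr`, the process `Φ` is a Markov chain with transition kernel `κ` and initial
distribution `μ`. The field `markov` says that the conditional probability of `Φ (n + 1) ∈ A` given
`σ(Φ 0, …, Φ n)` is `κ (Φ n) A`. -/
structure IsMarkovChain {Ω X : Type*} [MeasurableSpace Ω] [MeasurableSpace X]
    (Pr : Measure Ω) (κ : Kernel X X) (μ : Measure X) (Φ : ℕ → Ω → X) : Prop where
  measurable : ∀ n, Measurable (Φ n)
  initial : Pr.map (Φ 0) = μ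
  markov : ∀ (n : ℕ) (B : Set Ω) (A : Set X),
    MeasurableSet[⨆ j ∈ Finset.range (n + 1), MeasurableSpace.comap (Φ j) inferInstance] B →
    MeasurableSet A → Pr (B ∩ Φ (n + 1) ⁻¹' A) = ∫⁻ ω in B, κ (Φ n ω) A ∂Pr

/-- The time average `α_n = n⁻¹ ∑_{j < n} f(Φ_j)`. -/
def timeAverage {Ω X : Type*} (f : X → ℝ) (Φ : ℕ → Ω → X) (n : ℕ) (ω : Ω) : ℝ :=
  (1 / (n : ℝ)) * ∑ j ∈ Finset.range n, f (Φ j ω)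

/-- The likelihood ratio `L_n(θ) = ∏_{j=1}^n p(θ, Φ_{j-1}, Φ_j)`. -/
def likelihoodRatio {Ω X : Type*} {d : ℕ} (p : (Fin d → ℝ) → X → X → ℝ) (Φ : ℕ → Ω → X)
    (n : ℕ) (θ : Fin d → ℝ) (ω : Ω) : ℝ :=
  ∏ j ∈ Finset.range n, p θ (Φ j ω) (Φ (j + 1) ω)

end

end LRGradient

/-! Both sides are computed from one solution g of the Poisson equation g - Pg = f - α(θ₀), where P
= P(θ₀). Integrating it against π(θ), which is invariant for P(θ), gives α(θ) - α(θ₀) = π(θ)(P(θ) -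
P)g (`steadyState_sub`). Since π(θ)V is bounded uniformly in θ, convergence of the difference
quotients in operator norm first makes π(θ)u continuous along the axes for u dominated by V, and
then yields ∂_i α(θ₀) = π(θ₀)P^(i)g (`hasLineDerivAt_steadyState`).

On the probabilistic side p(θ₀) = 1 almost surely along the chain, so ∂_i L_n(θ₀) is a sum M_n of
scores, a martingale because the score has conditional mean zero. The Poisson equation gives n α_n =
n α(θ₀) + g(Φ_0) - g(Φ_n) + N_n, where the martingale N_n has increments g(Φ_{k+1}) - Pg(Φ_k). In
E[α_n M_n] the constant and g(Φ_0) contribute nothing, g(Φ_n) contributes O(n^{-1/2}), and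
orthogonality of increments gives E[M_n N_n] = ∑_{k<n} E[P^(i)g(Φ_k)]. Divided by n this tends to
π(θ₀)P^(i)g (`tendsto_average`). The L² estimates need |g| dominated by √V, so the equation is
solved for the weight √V, which inherits the drift condition (`DriftMinorization.sqrt`).

Existence and uniqueness of π(θ) and solvability of the Poisson equation rest on a Harris-type
theorem. The minorization concerns P^m and the chain may be periodic, so P itself need not contract;
an average Q of powers P^(m+j) does, in a weighted oscillation seminorm (`exists_osc_contraction`,
`exists_regularizes`). The factorization 1 - Q = (1 - P)S, with S a polynomial in P, transfers the
results from Q to P. -/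

namespace LRGradient

/-! ### Weighted function space and iterated drift inequalities. -/

noncomputable section

variable {X : Type*} [MeasurableSpace X]

/-- The space of measurable functions dominated by a multiple of `V`. -/
def wBounded (V : X → ℝ) : Submodule ℝ (X → ℝ) where
  carrier := {φ | Measurable φ ∧ ∃ M, ∀ x, |φ x| ≤ M * V x}
  add_mem' := by
    rintro φ ψ ⟨hφ, M, hM⟩ ⟨hψ, N, hN⟩
    refine ⟨hφ.add hψ, M + N, fun x => ?_⟩
    calc |φ x + ψ x| ≤ |φ x| + |ψ x| := abs_add_le _ _
      _ ≤ (M + N) * V x := by linarith [hM x, hN x]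
  zero_mem' := ⟨measurable_const, 0, fun x => by simp⟩
  smul_mem' := by
    rintro c φ ⟨hφ, M, hM⟩
    refine ⟨hφ.const_smul c, |c| * M, fun x => ?_⟩
    simp only [Pi.smul_apply, smul_eq_mul, abs_mul, mul_assoc]
    exact mul_le_mul_of_nonneg_left (hM x) (abs_nonneg c)

instance (V : X → ℝ) : CoeFun (wBounded V) (fun _ => X → ℝ) := ⟨fun φ => φ.1⟩

lemma wBounded_measurable {V : X → ℝ} (φ : wBounded V) : Measurable φ := φ.2.1

lemma wBounded_exists_nonneg_bound {V : X → ℝ} (hV : ∀ x, 1 ≤ V x) (φ : wBounded V) :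
    ∃ M, 0 ≤ M ∧ ∀ x, |φ x| ≤ M * V x := by
  obtain ⟨M, hM⟩ := φ.2.2
  refine ⟨max M 0, le_max_right _ _, fun x => (hM x).trans ?_⟩
  exact mul_le_mul_of_nonneg_right (le_max_left _ _) (zero_le_one.trans (hV x))

lemma wBounded_integrable {V : X → ℝ} (φ : wBounded V) {ρ : Measure X} (hρ : Integrable V ρ) :
    Integrable φ ρ := by
  obtain ⟨M, hM⟩ := φ.2.2
  refine (hρ.const_mul M).mono' (wBounded_measurable φ).aestronglyMeasurable (ae_of_all _ fun x => ?_)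
  exact hM x

/-- A Markov kernel with a geometric drift towards a small set. -/
structure DriftMinorization (κ : Kernel X X) (K : Set X) (δ : ℝ) (m : ℕ) (ν : Measure X)
    (V : X → ℝ) (lam b : ℝ) : Prop where
  markov : IsMarkovKernel κ
  small_measurable : MeasurableSet K
  delta_pos : 0 < δ
  one_le_m : 1 ≤ m
  prob : IsProbabilityMeasure ν
  small : ∀ x ∈ K, ENNReal.ofReal δ • ν ≤ (κ ^ m) x
  V_measurable : Measurable V
  one_le_V : ∀ x, 1 ≤ V x
  lam_pos : 0 < lam
  lam_lt_one : lam < 1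
  b_pos : 0 < b
  drift : ∀ x,
    ∫⁻ y, ENNReal.ofReal (V y) ∂(κ x) ≤ ENNReal.ofReal (lam * V x + K.indicator (fun _ => b) x)

lemma isMarkovKernel_pow (κ : Kernel X X) [IsMarkovKernel κ] (n : ℕ) : IsMarkovKernel (κ ^ n) := by
  induction n with
  | zero => exact inferInstanceAs (IsMarkovKernel (Kernel.id : Kernel X X))
  | succ n ih => rw [pow_succ]; exact inferInstanceAs (IsMarkovKernel ((κ ^ n) ∘ₖ κ))

lemma lintegral_kernel_pow_succ (κ : Kernel X X) (n : ℕ) (x : X) {F : X → ℝ≥0∞}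
    (hF : Measurable F) :
    ∫⁻ y, F y ∂((κ ^ (n + 1)) x) = ∫⁻ z, ∫⁻ y, F y ∂((κ ^ n) z) ∂(κ x) := by
  rw [pow_succ]
  exact Kernel.lintegral_comp _ _ _ hF

namespace DriftMinorization

variable {κ : Kernel X X} {K : Set X} {δ : ℝ} {m : ℕ} {ν : Measure X} {V : X → ℝ} {lam b : ℝ}

section basics

variable (H : DriftMinorization κ K δ m ν V lam b)
include H

lemma V_pos (x : X) : 0 < V x := zero_lt_one.trans_le (H.one_le_V x)

lemma integrable_iff_lintegral {ρ : Measure X} :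
    Integrable V ρ ↔ ∫⁻ y, ENNReal.ofReal (V y) ∂ρ < ∞ := by
  rw [← hasFiniteIntegral_iff_ofReal (ae_of_all _ fun x => (H.V_pos x).le)]
  exact ⟨fun h => h.2, fun h => ⟨H.V_measurable.aestronglyMeasurable, h⟩⟩

/-- The drift is iterated with the indicator bounded by 1. The computation stays in [0, ∞] because
integrability of `V` under the iterates is only a consequence of it. -/
lemma lintegral_pow_le_geom_sum (n : ℕ) (x : X) :
    ∫⁻ y, ENNReal.ofReal (V y) ∂((κ ^ n) x)
      ≤ ENNReal.ofReal (lam ^ n * V x + b * (1 - lam ^ n) / (1 - lam)) := by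
  have := H.markov
  have h1 : 0 < 1 - lam := by linarith [H.lam_lt_one]
  have hc (n : ℕ) : 0 ≤ b * (1 - lam ^ n) / (1 - lam) :=
    div_nonneg (mul_nonneg H.b_pos.le
      (sub_nonneg.2 (pow_le_one₀ H.lam_pos.le H.lam_lt_one.le))) h1.le
  induction n generalizing x with
  | zero =>
    have : (κ ^ 0) x = Measure.dirac x := by rw [pow_zero]; exact Kernel.id_apply x
    rw [this, lintegral_dirac' _ H.V_measurable.ennreal_ofReal]
    exact ENNReal.ofReal_le_ofReal (by simp)
  | succ n ih =>
    have hl : 0 ≤ lam ^ n := pow_nonneg H.lam_pos.le n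
    have hi : K.indicator (fun _ => b) x ≤ b :=
      Set.indicator_le_self' (fun _ _ => H.b_pos.le) x
    have hi' : 0 ≤ K.indicator (fun _ => b) x := Set.indicator_nonneg (fun _ _ => H.b_pos.le) x
    rw [lintegral_kernel_pow_succ _ _ _ H.V_measurable.ennreal_ofReal]
    calc ∫⁻ z, ∫⁻ y, ENNReal.ofReal (V y) ∂((κ ^ n) z) ∂(κ x)
        ≤ ∫⁻ z, (ENNReal.ofReal (lam ^ n) * ENNReal.ofReal (V z)
            + ENNReal.ofReal (b * (1 - lam ^ n) / (1 - lam))) ∂(κ x) := by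
          refine lintegral_mono fun z => (ih z).trans ?_
          rw [ENNReal.ofReal_add (mul_nonneg hl (H.V_pos z).le) (hc n), ENNReal.ofReal_mul hl]
      _ = ENNReal.ofReal (lam ^ n) * ∫⁻ z, ENNReal.ofReal (V z) ∂(κ x)
            + ENNReal.ofReal (b * (1 - lam ^ n) / (1 - lam)) := by
          rw [lintegral_add_right _ measurable_const,
            lintegral_const_mul _ H.V_measurable.ennreal_ofReal]
          simp
      _ ≤ ENNReal.ofReal (lam ^ n) * ENNReal.ofReal (lam * V x + K.indicator (fun _ => b) x)
            + ENNReal.ofReal (b * (1 - lam ^ n) / (1 - lam)) := by gcongr; exact H.drift x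
      _ ≤ _ := by
          rw [← ENNReal.ofReal_mul hl, ← ENNReal.ofReal_add _ (hc n)]
          · refine ENNReal.ofReal_le_ofReal ?_
            have : b * (1 - lam ^ (n + 1)) / (1 - lam)
                = lam ^ n * b + b * (1 - lam ^ n) / (1 - lam) := by
              field_simp; ring
            rw [this, pow_succ]
            nlinarith [mul_le_mul_of_nonneg_left hi hl]
          · exact mul_nonneg hl (add_nonneg (mul_nonneg H.lam_pos.le (H.V_pos x).le) hi')

lemma const_nonneg : 0 ≤ b / (1 - lam) :=
  div_nonneg H.b_pos.le (by linarith [H.lam_lt_one])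

lemma lintegral_pow_le (n : ℕ) (x : X) :
    ∫⁻ y, ENNReal.ofReal (V y) ∂((κ ^ n) x) ≤ ENNReal.ofReal (lam ^ n * V x + b / (1 - lam)) := by
  refine (H.lintegral_pow_le_geom_sum n x).trans (ENNReal.ofReal_le_ofReal ?_)
  have h1 : 0 < 1 - lam := by linarith [H.lam_lt_one]
  have : b * (1 - lam ^ n) / (1 - lam) ≤ b / (1 - lam) :=
    div_le_div_of_nonneg_right
      (mul_le_of_le_one_right H.b_pos.le (by linarith [pow_nonneg H.lam_pos.le n])) h1.le
  linarith

lemma integrable_V_pow (n : ℕ) (x : X) : Integrable V ((κ ^ n) x) :=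
  H.integrable_iff_lintegral.2 ((H.lintegral_pow_le n x).trans_lt ENNReal.ofReal_lt_top)

lemma integrable_V_kernel (x : X) : Integrable V (κ x) := by
  simpa using H.integrable_V_pow 1 x

lemma integral_pow_le (n : ℕ) (x : X) :
    ∫ y, V y ∂((κ ^ n) x) ≤ lam ^ n * V x + b / (1 - lam) := by
  rw [integral_eq_lintegral_of_nonneg_ae (ae_of_all _ fun y => (H.V_pos y).le)
    H.V_measurable.aestronglyMeasurable]
  refine ENNReal.toReal_le_of_le_ofReal ?_ (H.lintegral_pow_le n x)
  exact add_nonneg (mul_nonneg (pow_nonneg H.lam_pos.le n) (H.V_pos x).le) H.const_nonneg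

lemma integral_le (x : X) : ∫ y, V y ∂(κ x) ≤ lam * V x + K.indicator (fun _ => b) x := by
  rw [integral_eq_lintegral_of_nonneg_ae (ae_of_all _ fun y => (H.V_pos y).le)
    H.V_measurable.aestronglyMeasurable]
  refine ENNReal.toReal_le_of_le_ofReal ?_ (H.drift x)
  exact add_nonneg (mul_nonneg H.lam_pos.le (H.V_pos x).le)
    (Set.indicator_nonneg (fun _ _ => H.b_pos.le) x)

lemma integral_mem {φ : X → ℝ} (hφ : φ ∈ wBounded V) :
    (fun x => ∫ y, φ y ∂(κ x)) ∈ wBounded V := by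
  have := H.markov
  obtain ⟨M, hM0, hM⟩ := wBounded_exists_nonneg_bound H.one_le_V ⟨φ, hφ⟩
  refine ⟨(hφ.1.stronglyMeasurable.integral_kernel (κ := κ)).measurable, M * (lam + b),
    fun x => ?_⟩
  calc |∫ y, φ y ∂(κ x)| ≤ ∫ y, M * V y ∂(κ x) := by
        rw [← Real.norm_eq_abs]
        exact norm_integral_le_of_norm_le ((H.integrable_V_kernel x).const_mul M) (ae_of_all _ hM)
    _ = M * ∫ y, V y ∂(κ x) := integral_const_mul _ _
    _ ≤ M * ((lam + b) * V x) := by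
        refine mul_le_mul_of_nonneg_left ((H.integral_le x).trans ?_) hM0
        have hi : K.indicator (fun _ => b) x ≤ b :=
          Set.indicator_le_self' (fun _ _ => H.b_pos.le) x
        nlinarith [H.one_le_V x, H.b_pos]
    _ = M * (lam + b) * V x := by ring

/-- The transition operator on functions dominated by a multiple of `V`. -/
def op : Module.End ℝ (wBounded V) where
  toFun φ := ⟨fun x => ∫ y, φ y ∂(κ x), H.integral_mem φ.2⟩
  map_add' φ ψ := by
    ext x
    exact integral_add (wBounded_integrable φ (H.integrable_V_kernel x))
      (wBounded_integrable ψ (H.integrable_V_kernel x))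
  map_smul' c φ := by
    ext x
    exact integral_const_mul c _

lemma op_apply (φ : wBounded V) (x : X) : H.op φ x = ∫ y, φ y ∂(κ x) := rfl

lemma op_pow_apply (n : ℕ) (φ : wBounded V) (x : X) :
    (H.op ^ n) φ x = ∫ y, φ y ∂((κ ^ n) x) := by
  induction n generalizing x with
  | zero =>
    have : (κ ^ 0) x = Measure.dirac x := by rw [pow_zero]; exact Kernel.id_apply x
    rw [this, integral_dirac' _ _ (wBounded_measurable φ).stronglyMeasurable]
    simp
  | succ n ih =>
    have h1 : κ ^ (n + 1) = (κ ^ n) ∘ₖ κ := pow_succ _ _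
    rw [h1, Kernel.integral_comp, pow_succ', Module.End.mul_apply, op_apply]
    · exact integral_congr_ae (ae_of_all _ ih)
    · rw [← h1]
      exact wBounded_integrable φ (H.integrable_V_pow _ x)

/-- `V` as an element of the space it defines. -/
def wV : wBounded V := ⟨V, H.V_measurable, 1, fun x => by simp [abs_of_pos (H.V_pos x)]⟩

/-- The constant function `1`. -/
def wOne : wBounded V :=
  ⟨fun _ => 1, measurable_const, 1, fun x => by simpa using H.one_le_V x⟩

/-- The indicator function of a measurable set. -/
def wInd {A : Set X} (hA : MeasurableSet A) : wBounded V :=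
  ⟨A.indicator (fun _ => 1), measurable_const.indicator hA, 1, fun x => by
    rw [one_mul, abs_of_nonneg (Set.indicator_nonneg (fun _ _ => zero_le_one) x)]
    exact (Set.indicator_le_self' (fun _ _ => zero_le_one) x).trans (H.one_le_V x)⟩

@[simp] lemma wV_apply (x : X) : H.wV x = V x := rfl

@[simp] lemma wOne_apply (x : X) : H.wOne x = 1 := rfl

lemma wInd_apply {A : Set X} (hA : MeasurableSet A) (x : X) :
    H.wInd hA x = A.indicator (fun _ => 1) x := rfl

lemma op_nonneg {φ : wBounded V} (hφ : ∀ x, 0 ≤ φ x) (x : X) : 0 ≤ H.op φ x :=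
  integral_nonneg hφ

lemma op_one : H.op H.wOne = H.wOne := by
  have := H.markov
  ext x
  simp [op_apply, wOne]

lemma op_pow_nonneg (n : ℕ) {φ : wBounded V} (hφ : ∀ x, 0 ≤ φ x) (x : X) :
    0 ≤ (H.op ^ n) φ x := by
  rw [op_pow_apply]; exact integral_nonneg hφ

lemma op_pow_one (n : ℕ) : (H.op ^ n) H.wOne = H.wOne := by
  induction n with
  | zero => rfl
  | succ n ih => rw [pow_succ, Module.End.mul_apply, op_one, ih]

lemma op_pow_V_le (n : ℕ) (x : X) :
    (H.op ^ n) H.wV x ≤ lam ^ n * V x + b / (1 - lam) := by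
  rw [op_pow_apply]; exact H.integral_pow_le n x

/-- The expected number of visits to the small set is bounded below. -/
lemma op_pow_V_le_sum (n : ℕ) (x : X) :
    (H.op ^ n) H.wV x ≤ lam ^ n * V x
      + b * ∑ j ∈ Finset.range n, (H.op ^ j) (H.wInd H.small_measurable) x := by
  induction n generalizing x with
  | zero => simp
  | succ n ih =>
    set I := H.wInd H.small_measurable with hI
    let U : wBounded V := lam ^ n • H.wV + b • ∑ j ∈ Finset.range n, (H.op ^ j) I
    have hUx (x : X) : U x = lam ^ n * V x + b * ∑ j ∈ Finset.range n, (H.op ^ j) I x := by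
      simp [U, Finset.sum_apply]
    -- The positive operator is applied to the inductive inequality. Keeping the indicator, rather
    -- than bounding it by 1, is what later forces visits to `K`.
    have h1 : 0 ≤ H.op (U - (H.op ^ n) H.wV) x := by
      refine H.op_nonneg (fun y => ?_) x
      have := ih y
      rw [← hUx] at this
      simpa using this
    have h2 : H.op (U - (H.op ^ n) H.wV) = lam ^ n • H.op H.wV
        + b • ∑ j ∈ Finset.range n, (H.op ^ (j + 1)) I - (H.op ^ (n + 1)) H.wV := by
      simp only [U, map_sub, map_add, map_smul, map_sum, pow_succ', Module.End.mul_apply]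
    rw [h2] at h1
    have h3 : (H.op ^ (n + 1)) H.wV x
        ≤ lam ^ n * H.op H.wV x + b * ∑ j ∈ Finset.range n, (H.op ^ (j + 1)) I x := by
      simpa [Finset.sum_apply] using h1
    have h4 : H.op H.wV x ≤ lam * V x + b * I x := by
      refine (H.integral_le x).trans (le_of_eq ?_)
      by_cases hx : x ∈ K <;> simp [hI, wInd_apply, hx]
    have hI0 : 0 ≤ I x := Set.indicator_nonneg (fun _ _ => zero_le_one) x
    rw [Finset.sum_range_succ']
    have h5 : (H.op ^ 0) I x = I x := by simp
    rw [h5, pow_succ lam]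
    have hl : 0 ≤ lam ^ n := pow_nonneg H.lam_pos.le n
    -- The factor `lam ^ n` in front of the new visit term is simply discarded.
    have hl1 : lam ^ n ≤ 1 := pow_le_one₀ H.lam_pos.le H.lam_lt_one.le
    nlinarith [mul_le_mul_of_nonneg_left h4 hl,
      mul_le_mul_of_nonneg_right hl1 (mul_nonneg H.b_pos.le hI0)]

end basics

end DriftMinorization
end

/-! ### Contraction of weighted oscillations. -/

noncomputable section

variable {X : Type*} [MeasurableSpace X]

/-- A function whose oscillation is dominated by `w x + w y` is, up to a constant, dominated
by `w`. -/
lemma exists_center_of_osc_le {Y : Type*} [Nonempty Y] {φ w : Y → ℝ} (h : ∀ x y, |φ x - φ y| ≤ w x + w y) :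
    ∃ c, ∀ x, |φ x - c| ≤ w x := by
  have hb : BddAbove (Set.range fun x => φ x - w x) := by
    obtain ⟨y⟩ := ‹Nonempty Y›
    refine ⟨φ y + w y, ?_⟩
    rintro _ ⟨x, rfl⟩
    dsimp only
    linarith [le_abs_self (φ x - φ y), h x y]
  -- Any number between sup (φ - w) and inf (φ + w) is a center; the hypothesis says that the first
  -- does not exceed the second.
  refine ⟨⨆ x, (φ x - w x), fun x => abs_le.2 ⟨?_, ?_⟩⟩
  · have : ⨆ x, (φ x - w x) ≤ φ x + w x :=
      ciSup_le fun y => by linarith [le_abs_self (φ y - φ x), h y x]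
    linarith
  · linarith [le_ciSup hb x]

namespace DriftMinorization

variable {κ : Kernel X X} {K : Set X} {δ : ℝ} {m : ℕ} {ν : Measure X} {V : X → ℝ} {lam b : ℝ}
variable (H : DriftMinorization κ K δ m ν V lam b)

/-- `Q` is a positive operator preserving constants. -/
structure IsMarkovOp (Q : Module.End ℝ (wBounded V)) : Prop where
  nonneg : ∀ {φ : wBounded V}, (∀ x, 0 ≤ φ x) → ∀ x, 0 ≤ Q φ x
  map_one : Q H.wOne = H.wOne

include H

lemma isMarkovOp_op : H.IsMarkovOp H.op := ⟨fun h => H.op_nonneg h, H.op_one⟩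

variable {H} in
lemma IsMarkovOp.abs_sub_le {Q : Module.End ℝ (wBounded V)} (hQ : H.IsMarkovOp Q)
    {ψ W : wBounded V} (hψ : ∀ x, |ψ x| ≤ W x) (x : X) : |Q ψ x| ≤ Q W x := by
  have h1 := hQ.nonneg (φ := W - ψ) (fun y => by
    have := (abs_le.1 (hψ y)).2
    simpa using this) x
  have h2 := hQ.nonneg (φ := W + ψ) (fun y => by
    have := (abs_le.1 (hψ y)).1
    simp only [Submodule.coe_add, Pi.add_apply]
    linarith) x
  simp only [map_sub, map_add, Submodule.coe_sub, Submodule.coe_add, Pi.sub_apply,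
    Pi.add_apply] at h1 h2
  exact abs_le.2 ⟨by linarith, by linarith⟩

/-- Weighted contraction of oscillations under a drift and a minorization condition. -/
theorem exists_osc_contraction [Nonempty X] {Q : Module.End ℝ (wBounded V)} (hQ : H.IsMarkovOp Q)
    {γ C η R : ℝ} (hγ0 : 0 ≤ γ) (hγ1 : γ < 1) (hC : 0 < C) (hη : 0 < η) (hη1 : η ≤ 1)
    (hR : 4 * C ≤ (1 - γ) * R) (hdrift : ∀ x, Q H.wV x ≤ γ * V x + C)
    (ℓ : wBounded V →ₗ[ℝ] ℝ) (hℓ1 : ℓ H.wOne = 1) (hℓV : 0 ≤ ℓ H.wV)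
    (hmin : ∀ x, V x ≤ R → ∀ φ : wBounded V, (∀ y, 0 ≤ φ y) → η * ℓ φ ≤ Q φ x) :
    ∃ a β : ℝ, 0 ≤ a ∧ a < 1 ∧ 0 < β ∧ ∀ (M : ℝ) (φ : wBounded V),
      (∀ x y, |φ x - φ y| ≤ M * (2 + β * (V x + V y))) →
      ∀ x y, |Q φ x - Q φ y| ≤ a * M * (2 + β * (V x + V y)) := by
  have hg : 0 < 1 - γ := by linarith
  have hR0 : 0 < R := by
    by_contra hcon
    nlinarith
  -- With 2βC = η, half of the gain 2η from the minorization at two points pays for the drift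
  -- constant.
  set β := η / (2 * C) with hβdef
  have hβ : 0 < β := by positivity
  have hβC : 2 * (β * C) = η := by rw [hβdef]; field_simp
  -- The ratio (2 + β(1+γ)s/2) / (2 + βs) decreases in s; `a'` is its value at s = R and so bounds
  -- it for s > R.
  set a' := (2 + β * ((1 + γ) / 2) * R) / (2 + β * R) with ha'
  have hden : 0 < 2 + β * R := by positivity
  have ha'1 : a' < 1 := by
    rw [ha', div_lt_one hden]
    nlinarith [mul_pos hβ hR0]
  have ha'γ : (1 + γ) / 2 ≤ a' := by
    rw [ha', le_div_iff₀ hden]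
    nlinarith
  have ha'eq : 2 * (1 - a') = β * (a' - (1 + γ) / 2) * R := by
    have : a' * (2 + β * R) = 2 + β * ((1 + γ) / 2) * R := div_mul_cancel₀ _ hden.ne'
    linarith
  refine ⟨max (1 - η / 2) a', β, le_max_of_le_left (by linarith), max_lt (by linarith) ha'1, hβ,
    fun M φ hφ x y => ?_⟩
  set a := max (1 - η / 2) a'
  have ha1 : 1 - η / 2 ≤ a := le_max_left _ _
  have ha2 : a' ≤ a := le_max_right _ _
  have hM : 0 ≤ M := by
    have h1 := (abs_nonneg _).trans (hφ x x)
    have h2 : 0 < 2 + β * (V x + V x) := by have := H.V_pos x; positivity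
    exact nonneg_of_mul_nonneg_left h1 h2
  let W : wBounded V := M • (H.wOne + β • H.wV)
  have hW (x : X) : W x = M * (1 + β * V x) := by
    simp [W]
    ring
  obtain ⟨c, hc⟩ := exists_center_of_osc_le (φ := φ) (w := W) (fun x y => by
    rw [hW, hW]; exact (hφ x y).trans_eq (by ring))
  let ψ : wBounded V := φ - c • H.wOne
  have hψ (x : X) : |ψ x| ≤ W x := by simpa [ψ] using hc x
  have hQψ (x : X) : Q ψ x = Q φ x - c := by simp [ψ, hQ.map_one]
  have hQW (x : X) : Q W x ≤ M * (1 + β * (γ * V x + C)) := by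
    have : Q W x = M * (1 + β * Q H.wV x) := by
      simp [W, hQ.map_one]
      ring
    rw [this]
    gcongr
    exact hdrift x
  have hℓW : M ≤ ℓ W := by
    have : ℓ W = M * (1 + β * ℓ H.wV) := by
      simp [W, hℓ1]
      ring
    rw [this]
    nlinarith [mul_nonneg hM (mul_nonneg hβ.le hℓV)]
  -- The functional Q(·)(x) - eℓ is positive, so it may be applied to W ± ψ. The loss eℓ(W) is at
  -- least eM, and the common shift eℓ(ψ) cancels when two points are compared.
  have key (e : ℝ) (he : 0 ≤ e) (x : X)
      (hx : ∀ φ : wBounded V, (∀ y, 0 ≤ φ y) → e * ℓ φ ≤ Q φ x) :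
      |Q φ x - c - e * ℓ ψ| ≤ M * (1 + β * (γ * V x + C)) - e * M := by
    have h1 := hx (W - ψ) (fun y => by simpa using (abs_le.1 (hψ y)).2)
    have h2 := hx (W + ψ) (fun y => by
      have := (abs_le.1 (hψ y)).1
      simp only [Submodule.coe_add, Pi.add_apply]
      linarith)
    simp only [map_sub, map_add, Submodule.coe_sub, Submodule.coe_add, Pi.sub_apply,
      Pi.add_apply, hQψ] at h1 h2
    have h3 := hQW x
    have h4 := mul_le_mul_of_nonneg_left hℓW he
    exact abs_le.2 ⟨by linarith, by linarith⟩
  have comb (e : ℝ) (he : 0 ≤ e)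
      (hx : ∀ φ : wBounded V, (∀ y, 0 ≤ φ y) → e * ℓ φ ≤ Q φ x)
      (hy : ∀ φ : wBounded V, (∀ y, 0 ≤ φ y) → e * ℓ φ ≤ Q φ y) :
      |Q φ x - Q φ y| ≤ M * (2 + β * γ * (V x + V y) + 2 * (β * C) - 2 * e) := by
    have h1 := abs_le.1 (key e he x hx)
    have h2 := abs_le.1 (key e he y hy)
    exact abs_le.2 ⟨by linarith [h1.1, h2.2], by linarith [h1.2, h2.1]⟩
  have hVx := H.V_pos x
  have hVy := H.V_pos y
  set s := V x + V y with hs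
  have hs0 : 0 < s := by positivity
  have hbs : 0 < β * s := by positivity
  -- If V x + V y ≤ R, both points lie in the sublevel set and the minorization contracts; beyond R
  -- the drift alone suffices, with e = 0.
  rcases le_or_gt s R with hsR | hsR
  · refine (comb η hη.le (hmin x (by linarith)) (hmin y (by linarith))).trans ?_
    have : 2 + β * γ * s + 2 * (β * C) - 2 * η ≤ a * (2 + β * s) := by
      nlinarith [mul_le_mul_of_nonneg_right (show γ ≤ a by linarith) hbs.le]
    calc _ ≤ M * (a * (2 + β * s)) := mul_le_mul_of_nonneg_left this hM
      _ = _ := by ring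
  · refine (comb 0 le_rfl (fun φ h => by simpa using hQ.nonneg h x)
      (fun φ h => by simpa using hQ.nonneg h y)).trans ?_
    have h2C : 2 * C ≤ (1 - γ) / 2 * s := by nlinarith
    have h3 : β * γ * s + 2 * (β * C) ≤ β * ((1 + γ) / 2) * s := by
      nlinarith [mul_le_mul_of_nonneg_left h2C hβ.le]
    have h4 : 2 + β * ((1 + γ) / 2) * s ≤ a' * (2 + β * s) := by
      have : β * (a' - (1 + γ) / 2) * R ≤ β * (a' - (1 + γ) / 2) * s :=
        mul_le_mul_of_nonneg_left hsR.le (mul_nonneg hβ.le (by linarith))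
      linarith
    have h5 : a' * (2 + β * s) ≤ a * (2 + β * s) := mul_le_mul_of_nonneg_right ha2 (by linarith)
    calc _ ≤ M * (a * (2 + β * s)) := mul_le_mul_of_nonneg_left (by linarith) hM
      _ = _ := by ring

end DriftMinorization
end

/-! ### The averaged operator obtained from drift and minorization. -/

noncomputable section

variable {X : Type*} [MeasurableSpace X]

namespace DriftMinorization

variable {κ : Kernel X X} {K : Set X} {δ : ℝ} {m : ℕ} {ν : Measure X} {V : X → ℝ} {lam b : ℝ}
variable (H : DriftMinorization κ K δ m ν V lam b)
include H

lemma integrable_V_bind {ρ : Measure X} [IsProbabilityMeasure ρ] (hρ : Integrable V ρ) :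
    Integrable V (ρ.bind κ) := by
  rw [H.integrable_iff_lintegral, Measure.lintegral_bind κ.aemeasurable
    H.V_measurable.ennreal_ofReal.aemeasurable]
  refine (lintegral_mono H.drift).trans_lt (Integrable.lintegral_lt_top ?_)
  exact (hρ.const_mul lam).add ((integrable_const b).indicator H.small_measurable)

lemma integral_bind {ρ : Measure X} [IsProbabilityMeasure ρ] (hρ : Integrable V ρ)
    (φ : wBounded V) : ∫ x, φ x ∂(ρ.bind κ) = ∫ x, H.op φ x ∂ρ := by
  have h := wBounded_integrable φ (H.integrable_V_bind hρ)
  rw [Measure.comp_eq_comp_const_apply] at h ⊢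
  rw [Kernel.integral_comp h]
  rfl

/-- The probability measure `ρ'` represents the functional `φ ↦ ∫ Q φ dρ`. -/
def Represents (Q : Module.End ℝ (wBounded V)) (ρ ρ' : Measure X) : Prop :=
  IsProbabilityMeasure ρ' ∧ Integrable V ρ' ∧ ∀ φ : wBounded V, ∫ x, φ x ∂ρ' = ∫ x, Q φ x ∂ρ

/-- A positive operator on functions need not come from σ-additive measures, so the measures behind
the powers are carried along; the invariant law is a limit of such measures. -/
lemma exists_represents_pow (n : ℕ) {ρ : Measure X} [IsProbabilityMeasure ρ]
    (hρ : Integrable V ρ) : ∃ ρ' : Measure X, Represents (H.op ^ n) ρ ρ' := by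
  have := H.markov
  induction n with
  | zero => exact ⟨ρ, ‹_›, hρ, fun φ => rfl⟩
  | succ n ih =>
    obtain ⟨ρ', h1, h2, h3⟩ := ih
    refine ⟨ρ'.bind κ, inferInstance, H.integrable_V_bind h2, fun φ => ?_⟩
    rw [H.integral_bind h2, h3, pow_succ, Module.End.mul_apply]

lemma exists_represents_average (m n : ℕ) (hn : n ≠ 0) {ρ : Measure X} [IsProbabilityMeasure ρ]
    (hρ : Integrable V ρ) :
    ∃ ρ' : Measure X,
      Represents ((n : ℝ)⁻¹ • ∑ j ∈ Finset.range n, H.op ^ (m + j)) ρ ρ' := by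
  choose σ hσ using fun j => H.exists_represents_pow (m + j) hρ
  refine ⟨(n : ℝ≥0∞)⁻¹ • ∑ j ∈ Finset.range n, σ j, ⟨?_⟩, ?_, fun φ => ?_⟩
  · have (j : ℕ) : σ j Set.univ = 1 := (hσ j).1.measure_univ
    simp [this, ENNReal.inv_mul_cancel (Nat.cast_ne_zero.2 hn) (ENNReal.natCast_ne_top n)]
  · refine Integrable.smul_measure ?_ (by simp [hn])
    exact integrable_finsetSum_measure.2 fun j _ => (hσ j).2.1
  · rw [integral_smul_measure, integral_finsetSum_measure
      fun j _ => wBounded_integrable φ (hσ j).2.1]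
    have h1 (x : X) : ((n : ℝ)⁻¹ • ∑ j ∈ Finset.range n, H.op ^ (m + j)) φ x
        = (n : ℝ)⁻¹ * ∑ j ∈ Finset.range n, (H.op ^ (m + j)) φ x := by
      simp [Finset.sum_apply]
    simp_rw [h1, integral_const_mul]
    rw [integral_finsetSum _ fun j _ => wBounded_integrable _ hρ]
    simp only [ENNReal.toReal_inv, ENNReal.toReal_natCast, smul_eq_mul]
    congr 1
    exact Finset.sum_congr rfl fun j _ => (hσ j).2.2 φ

/-- Without visits to `K` the drift would give 1 ≤ κⁿV(x) ≤ lamⁿV(x), which tends to 0. -/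
lemma small_nonempty [Nonempty X] : K.Nonempty := by
  by_contra hK
  rw [Set.not_nonempty_iff_eq_empty] at hK
  subst hK
  obtain ⟨x⟩ := ‹Nonempty X›
  have h0 : H.wInd H.small_measurable = 0 := by ext; simp [wInd_apply]
  have h1 (n : ℕ) : 1 ≤ lam ^ n * V x := by
    have h2 := H.op_pow_V_le_sum n x
    rw [h0] at h2
    have h3 : 0 ≤ (H.op ^ n) (H.wV - H.wOne) x :=
      H.op_pow_nonneg n (fun y => by simpa using H.one_le_V y) x
    rw [map_sub, op_pow_one] at h3
    simp only [map_zero, Submodule.coe_zero, Pi.zero_apply, Finset.sum_const_zero, mul_zero,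
      add_zero, Submodule.coe_sub, Pi.sub_apply, wOne_apply] at h2 h3
    linarith
  have h2 : Tendsto (fun n : ℕ => lam ^ n * V x) atTop (𝓝 (0 * V x)) :=
    (tendsto_pow_atTop_nhds_zero_of_lt_one H.lam_pos.le H.lam_lt_one).mul_const _
  have := ge_of_tendsto' h2 h1
  norm_num at this

lemma integrable_V_small_measure [Nonempty X] : Integrable V ν := by
  obtain ⟨x, hx⟩ := H.small_nonempty
  have h1 := (H.integrable_V_pow m x).mono_measure (H.small x hx)
  exact (integrable_smul_measure (ENNReal.ofReal_pos.2 H.delta_pos).ne'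
    ENNReal.ofReal_ne_top).1 h1

/-- Integration against the minorizing measure, as a linear functional. -/
def smallFunctional [Nonempty X] : wBounded V →ₗ[ℝ] ℝ where
  toFun φ := ∫ x, φ x ∂ν
  map_add' φ ψ := integral_add (wBounded_integrable φ H.integrable_V_small_measure)
    (wBounded_integrable ψ H.integrable_V_small_measure)
  map_smul' c _ := integral_const_mul c _

lemma smallFunctional_le [Nonempty X] {φ : wBounded V} (hφ : ∀ x, 0 ≤ φ x) {x : X} (hx : x ∈ K) :
    δ * H.smallFunctional φ ≤ (H.op ^ m) φ x := by
  rw [op_pow_apply]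
  have := integral_mono_measure (H.small x hx) (ae_of_all _ hφ)
    (wBounded_integrable φ (H.integrable_V_pow m x))
  rwa [integral_smul_measure, ENNReal.toReal_ofReal H.delta_pos.le] at this

/-- `Q` is an average of powers of the transition operator which contracts oscillations. -/
structure Regularizes (Q S : Module.End ℝ (wBounded V)) (a β : ℝ) : Prop where
  isMarkovOp : H.IsMarkovOp Q
  one_sub_eq : 1 - Q = (1 - H.op) * S
  commute : Commute H.op Q
  represents : ∀ ρ : Measure X, IsProbabilityMeasure ρ → Integrable V ρ →
    ∃ ρ' : Measure X, Represents Q ρ ρ'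
  nonneg : 0 ≤ a
  lt_one : a < 1
  pos : 0 < β
  contraction : ∀ (M : ℝ) (φ : wBounded V),
    (∀ x y, |φ x - φ y| ≤ M * (2 + β * (V x + V y))) →
      ∀ x y, |Q φ x - Q φ y| ≤ a * M * (2 + β * (V x + V y))

/-- Since κⁿV ≥ 1, the iterated drift forces a definite expected number of visits to `K` before time
n from any point with V ≤ R; m steps after a visit the minorization acts. Averaging the powers m + j
over j < n removes the dependence on the visiting time. -/
theorem exists_regularizes [Nonempty X] : ∃ Q S a β, H.Regularizes Q S a β := by
  have h1 : 0 < 1 - lam := by linarith [H.lam_lt_one]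
  set C := b / (1 - lam) with hC
  have hC0 : 0 < C := div_pos H.b_pos h1
  set R := 4 * C / (1 - lam) with hR
  have hR0 : 0 < R := by positivity
  -- This leaves at least 1 - 1/2 for b times the expected number of visits.
  obtain ⟨n, hn⟩ : ∃ n : ℕ, lam ^ n * R ≤ 1 / 2 ∧ n ≠ 0 := by
    have h2 : Tendsto (fun n : ℕ => lam ^ n * R) atTop (𝓝 (0 * R)) :=
      (tendsto_pow_atTop_nhds_zero_of_lt_one H.lam_pos.le H.lam_lt_one).mul_const _
    rw [zero_mul] at h2
    exact ((h2.eventually (eventually_le_nhds (by norm_num : (0 : ℝ) < 1 / 2))).and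
      (eventually_ne_atTop 0)).exists
  obtain ⟨hn, hn0⟩ := hn
  have hnpos : (0 : ℝ) < n := Nat.cast_pos.2 (Nat.pos_of_ne_zero hn0)
  set Q : Module.End ℝ (wBounded V) := (n : ℝ)⁻¹ • ∑ j ∈ Finset.range n, H.op ^ (m + j) with hQ
  have hQx (φ : wBounded V) (x : X) :
      Q φ x = (n : ℝ)⁻¹ * ∑ j ∈ Finset.range n, (H.op ^ (m + j)) φ x := by
    simp [hQ, Finset.sum_apply]
  have hQm : H.IsMarkovOp Q := by
    refine ⟨fun {φ} hφ x => ?_, ?_⟩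
    · rw [hQx]
      exact mul_nonneg (by positivity) (Finset.sum_nonneg fun j _ => H.op_pow_nonneg _ hφ x)
    · ext x
      rw [hQx]
      simp [op_pow_one, hnpos.ne']
  -- At least 1/(2b) expected visits, each worth δ, averaged over n powers; the minimum with 1
  -- serves `exists_osc_contraction`.
  set η := min 1 (δ / (2 * b * n)) with hη
  have hη0 : 0 < η := lt_min one_pos (by have := H.delta_pos; have := H.b_pos; positivity)
  have hmin (x : X) (hx : V x ≤ R) (φ : wBounded V) (hφ : ∀ y, 0 ≤ φ y) :
      η * H.smallFunctional φ ≤ Q φ x := by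
    have := H.prob
    set I := H.wInd H.small_measurable
    have hℓ : 0 ≤ H.smallFunctional φ := integral_nonneg hφ
    have hvis : 1 / 2 ≤ b * ∑ j ∈ Finset.range n, (H.op ^ j) I x := by
      have h2 := H.op_pow_V_le_sum n x
      have h3 : 0 ≤ (H.op ^ n) (H.wV - H.wOne) x :=
        H.op_pow_nonneg n (fun y => by simpa using H.one_le_V y) x
      rw [map_sub, op_pow_one] at h3
      simp only [Submodule.coe_sub, Pi.sub_apply, wOne_apply] at h3
      have h4 : lam ^ n * V x ≤ lam ^ n * R :=
        mul_le_mul_of_nonneg_left hx (pow_nonneg H.lam_pos.le n)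
      linarith
    -- The pointwise bound κᵐφ ≥ δν(φ)1_K is propagated by the positive operator κʲ.
    have hstep (j : ℕ) : δ * H.smallFunctional φ * (H.op ^ j) I x ≤ (H.op ^ (m + j)) φ x := by
      have h2 : 0 ≤ (H.op ^ j) ((H.op ^ m) φ - (δ * H.smallFunctional φ) • I) x := by
        refine H.op_pow_nonneg j (fun y => ?_) x
        by_cases hy : y ∈ K
        · simpa [I, wInd_apply, hy] using H.smallFunctional_le hφ hy
        · simpa [I, wInd_apply, hy] using H.op_pow_nonneg m hφ y
      rw [map_sub, map_smul, ← Module.End.mul_apply, ← pow_add, add_comm j m] at h2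
      simpa using h2
    have hsum : δ * H.smallFunctional φ * ∑ j ∈ Finset.range n, (H.op ^ j) I x
        ≤ ∑ j ∈ Finset.range n, (H.op ^ (m + j)) φ x := by
      rw [Finset.mul_sum]
      exact Finset.sum_le_sum fun j _ => hstep j
    have hvis' : 1 / (2 * b) ≤ ∑ j ∈ Finset.range n, (H.op ^ j) I x := by
      rw [div_le_iff₀ (by linarith [H.b_pos])]
      linarith
    rw [hQx]
    calc η * H.smallFunctional φ ≤ δ / (2 * b * n) * H.smallFunctional φ :=
          mul_le_mul_of_nonneg_right (min_le_right _ _) hℓ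
      _ = (n : ℝ)⁻¹ * (δ * H.smallFunctional φ * (1 / (2 * b))) := by
          have := H.b_pos
          field_simp
      _ ≤ (n : ℝ)⁻¹ * (δ * H.smallFunctional φ * ∑ j ∈ Finset.range n, (H.op ^ j) I x) := by
          gcongr
          exact mul_nonneg H.delta_pos.le hℓ
      _ ≤ _ := by gcongr
  have hdrift (x : X) : Q H.wV x ≤ lam * V x + C := by
    have h2 : ∑ j ∈ Finset.range n, (H.op ^ (m + j)) H.wV x ≤ n * (lam * V x + C) := by
      calc _ ≤ ∑ j ∈ Finset.range n, (lam * V x + C) := by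
            refine Finset.sum_le_sum fun j _ => (H.op_pow_V_le _ x).trans ?_
            gcongr
            · exact (H.V_pos x).le
            -- Every exponent m + j is at least 1, so one factor `lam` always remains.
            · exact pow_le_of_le_one H.lam_pos.le H.lam_lt_one.le
                (by have := H.one_le_m; omega)
        _ = _ := by rw [Finset.sum_const, Finset.card_range, nsmul_eq_mul]
    rw [hQx, inv_mul_le_iff₀ hnpos]
    exact h2
  have hprob := H.prob
  obtain ⟨a, β, ha0, ha1, hβ, hcon⟩ := H.exists_osc_contraction hQm H.lam_pos.le H.lam_lt_one hC0
    hη0 (min_le_left _ _) (by rw [hR]; field_simp; rfl) hdrift H.smallFunctional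
    (by simp [smallFunctional]) (integral_nonneg fun x => (H.V_pos x).le) hmin
  refine ⟨Q, (n : ℝ)⁻¹ • ∑ j ∈ Finset.range n, ∑ i ∈ Finset.range (m + j), H.op ^ i, a, β, hQm, ?_,
    ?_, fun ρ _ hρ' => H.exists_represents_average m n hn0 hρ', ha0, ha1, hβ, hcon⟩
  -- Each 1 - κᵏ equals (1 - κ) times a geometric sum; `S` averages these sums.
  · rw [mul_smul_comm, Finset.mul_sum,
      Finset.sum_congr rfl fun j _ => mul_neg_geom_sum H.op (m + j)]
    have h2 : ∑ j ∈ Finset.range n, (1 - H.op ^ (m + j))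
        = (n : ℝ) • 1 - ∑ j ∈ Finset.range n, H.op ^ (m + j) := by
      rw [Finset.sum_sub_distrib (fun _ => (1 : Module.End ℝ (wBounded V)))
        (fun j => H.op ^ (m + j))]
      simp [← Nat.cast_smul_eq_nsmul ℝ]
    rw [h2]
    ext φ x
    simp only [LinearMap.sub_apply, Module.End.one_apply, LinearMap.smul_apply, Submodule.coe_sub,
      Submodule.coe_smul, Pi.sub_apply, Pi.smul_apply, smul_eq_mul, hQx, LinearMap.sum_apply,
      Submodule.coe_sum, Finset.sum_apply]
    field_simp
  · exact (Commute.sum_right _ _ _ fun j _ => (Commute.refl _).pow_right _).smul_right _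

end DriftMinorization
end

/-! ### Existence of an invariant probability measure. -/

noncomputable section

variable {X : Type*} [MeasurableSpace X]

/-- A uniform setwise limit of probability measures is a probability measure. -/
theorem exists_measure_of_uniform_limit (ρ : ℕ → Measure X) [∀ k, IsProbabilityMeasure (ρ k)]
    (L : Set X → ℝ) (e : ℕ → ℝ) (he : Tendsto e atTop (𝓝 0))
    (h : ∀ k A, MeasurableSet A → |(ρ k).real A - L A| ≤ e k) :
    ∃ π : Measure X, IsProbabilityMeasure π ∧ ∀ A, MeasurableSet A → π.real A = L A := by
  have hlim (A : Set X) (hA : MeasurableSet A) : Tendsto (fun k => (ρ k).real A) atTop (𝓝 (L A)) :=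
    tendsto_iff_dist_tendsto_zero.2
      (squeeze_zero (fun _ => dist_nonneg) (fun k => h k A hA) he)
  have hnonneg (A : Set X) (hA : MeasurableSet A) : 0 ≤ L A :=
    ge_of_tendsto' (hlim A hA) fun k => measureReal_nonneg
  have hempty : L ∅ = 0 := tendsto_nhds_unique (hlim ∅ .empty) (by simp)
  have huniv : L Set.univ = 1 := tendsto_nhds_unique (hlim _ .univ) (by simp)
  have hadd (A : ℕ → Set X) (hA : ∀ i, MeasurableSet (A i))
      (hd : Pairwise (Function.onFun Disjoint A)) (s : Finset ℕ) :
      ∑ i ∈ s, L (A i) = L (⋃ i ∈ s, A i) := by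
    refine tendsto_nhds_unique (tendsto_finsetSum s fun i _ => hlim (A i) (hA i)) ?_
    refine (hlim _ (s.measurableSet_biUnion fun i _ => hA i)).congr fun k => ?_
    exact measureReal_biUnion_finset (fun i _ j _ hij => hd hij) (fun i _ => hA i)
  have hsum (A : ℕ → Set X) (hA : ∀ i, MeasurableSet (A i))
      (hd : Pairwise (Function.onFun Disjoint A)) :
      HasSum (fun i => L (A i)) (L (⋃ i, A i)) := by
    have hk (k : ℕ) : HasSum (fun i => (ρ k).real (A i)) ((ρ k).real (⋃ i, A i)) := by
      have h1 : ∑' i, ρ k (A i) = ρ k (⋃ i, A i) := (measure_iUnion hd hA).symm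
      have h2 := ENNReal.hasSum_toReal (f := fun i => ρ k (A i)) (by rw [h1]; exact measure_ne_top _ _)
      rw [← ENNReal.tsum_toReal_eq (fun i => measure_ne_top _ _), h1] at h2
      exact h2
    -- Uniformity of the error over all sets permits one fixed k for every finite union and for the
    -- full union: a three-term estimate with r / 3.
    rw [HasSum, Metric.tendsto_nhds]
    intro r hr
    obtain ⟨k, hkr⟩ := (he.eventually (gt_mem_nhds (show (0 : ℝ) < r / 3 by positivity))).exists
    filter_upwards [Metric.tendsto_nhds.1 (hk k) (r / 3) (by positivity)] with s hs
    rw [hadd A hA hd s]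
    have h1 := h k _ (s.measurableSet_biUnion fun i _ => hA i)
    have h2 := h k _ (MeasurableSet.iUnion hA)
    have h3 : ∑ i ∈ s, (ρ k).real (A i) = (ρ k).real (⋃ i ∈ s, A i) :=
      (measureReal_biUnion_finset (fun i _ j _ hij => hd hij) (fun i _ => hA i)).symm
    rw [h3, Real.dist_eq] at hs
    rw [Real.dist_eq]
    rw [abs_lt] at hs ⊢
    rw [abs_le] at h1 h2
    exact ⟨by linarith [h1.1, h1.2, h2.1, h2.2, hs.1], by linarith [h1.1, h1.2, h2.1, h2.2, hs.2]⟩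
  let π : Measure X := Measure.ofMeasurable (fun A _ => ENNReal.ofReal (L A)) (by simp [hempty])
    (fun A hA hd => by
      rw [← (hsum A hA hd).tsum_eq, ENNReal.ofReal_tsum_of_nonneg
        (fun i => hnonneg _ (hA i)) (hsum A hA hd).summable])
  have hπ (A : Set X) (hA : MeasurableSet A) : π A = ENNReal.ofReal (L A) :=
    Measure.ofMeasurable_apply A hA
  refine ⟨π, ⟨by rw [hπ _ .univ, huniv, ENNReal.ofReal_one]⟩, fun A hA => ?_⟩
  rw [measureReal_def, hπ A hA, ENNReal.toReal_ofReal (hnonneg A hA)]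

/-- Setwise closeness of probability measures controls integrals of `[0, 1]`-valued functions. -/
theorem abs_integral_sub_le_of_measureReal_le {ρ π : Measure X} [IsProbabilityMeasure ρ]
    [IsProbabilityMeasure π] {e : ℝ} (h : ∀ A, MeasurableSet A → |ρ.real A - π.real A| ≤ e)
    {φ : X → ℝ} (hφ : Measurable φ) (h0 : ∀ x, 0 ≤ φ x) (h1 : ∀ x, φ x ≤ 1) :
    |∫ x, φ x ∂ρ - ∫ x, φ x ∂π| ≤ e := by
  have hint (σ : Measure X) [IsProbabilityMeasure σ] : Integrable φ σ :=
    (integrable_const (1 : ℝ)).mono' hφ.aestronglyMeasurable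
      (ae_of_all _ fun x => by rw [Real.norm_eq_abs, abs_of_nonneg (h0 x)]; exact h1 x)
  have hanti (σ : Measure X) [IsProbabilityMeasure σ] :
      Antitone fun t : ℝ => σ.real {x | t ≤ φ x} :=
    fun s t hst => measureReal_mono fun x hx => hst.trans hx
  have hI (σ : Measure X) [IsProbabilityMeasure σ] :
      IntegrableOn (fun t : ℝ => σ.real {x | t ≤ φ x}) (Set.Ioc 0 1) := by
    refine (integrable_const (1 : ℝ)).mono' (hanti σ).measurable.aestronglyMeasurable
      (ae_of_all _ fun t => ?_)
    rw [Real.norm_eq_abs, abs_of_nonneg measureReal_nonneg]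
    exact measureReal_le_one
  -- Layer-cake formula: the level sets are compared at each t in (0, 1].
  rw [(hint ρ).integral_eq_integral_Ioc_meas_le (ae_of_all _ h0) (ae_of_all _ h1),
    (hint π).integral_eq_integral_Ioc_meas_le (ae_of_all _ h0) (ae_of_all _ h1),
    ← integral_sub (hI ρ) (hI π)]
  have := norm_setIntegral_le_of_norm_le_const (μ := volume) (s := Set.Ioc (0 : ℝ) 1) (C := e)
    (f := fun t => ρ.real {x | t ≤ φ x} - π.real {x | t ≤ φ x}) (by simp)
    (fun t _ => h _ (measurableSet_le measurable_const hφ))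
  simpa using this

namespace DriftMinorization

variable {κ : Kernel X X} {K : Set X} {δ : ℝ} {m : ℕ} {ν : Measure X} {V : X → ℝ} {lam b : ℝ}
variable {H : DriftMinorization κ K δ m ν V lam b}
variable {Q S : Module.End ℝ (wBounded V)} {a β : ℝ}

lemma Regularizes.osc_pow_le (h : H.Regularizes Q S a β) {M : ℝ} {φ : wBounded V}
    (hφ : ∀ x y, |φ x - φ y| ≤ M * (2 + β * (V x + V y))) (k : ℕ) (x y : X) :
    |(Q ^ k) φ x - (Q ^ k) φ y| ≤ a ^ k * M * (2 + β * (V x + V y)) := by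
  induction k generalizing x y with
  | zero => simpa using hφ x y
  | succ k ih =>
    rw [pow_succ', Module.End.mul_apply]
    exact (h.contraction _ _ ih x y).trans_eq (by ring)

lemma Regularizes.exists_osc_bound (h : H.Regularizes Q S a β) (φ : wBounded V) :
    ∃ M, 0 ≤ M ∧ ∀ x y, |φ x - φ y| ≤ M * (2 + β * (V x + V y)) := by
  obtain ⟨M, hM0, hM⟩ := wBounded_exists_nonneg_bound H.one_le_V φ
  have hβ := h.pos
  refine ⟨M / β, by positivity, fun x y => ?_⟩
  calc |φ x - φ y| ≤ |φ x| + |φ y| := abs_sub _ _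
    _ ≤ M / β * (β * (V x + V y)) := by
        have : M / β * (β * (V x + V y)) = M * V x + M * V y := by field_simp
        linarith [hM x, hM y]
    _ ≤ _ := by gcongr; linarith

/-- As Q fixes constants, Qψ(x) - ψ(x) is Q applied to ψ - ψ(x), and positivity transfers the
pointwise bound. -/
lemma IsMarkovOp.abs_apply_sub_le {Q : Module.End ℝ (wBounded V)} (hQ : H.IsMarkovOp Q)
    {ψ : wBounded V} {r : ℝ} {x : X} (hψ : ∀ y, |ψ y - ψ x| ≤ r * (2 + β * (V x + V y))) :
    |Q ψ x - ψ x| ≤ r * (2 + β * (V x + Q H.wV x)) := by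
  have h1 := hQ.abs_sub_le (ψ := ψ - (ψ x) • H.wOne)
    (W := r • ((2 + β * V x) • H.wOne + β • H.wV)) (fun y => by
      simp only [Submodule.coe_sub, Submodule.coe_smul, Submodule.coe_add, Pi.sub_apply,
        Pi.smul_apply, Pi.add_apply, wOne_apply, wV_apply, smul_eq_mul, mul_one]
      exact (hψ y).trans_eq (by ring)) x
  simp only [map_sub, map_add, map_smul, hQ.map_one, Submodule.coe_sub, Submodule.coe_smul,
    Submodule.coe_add, Pi.sub_apply, Pi.smul_apply, Pi.add_apply, wOne_apply, smul_eq_mul,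
    mul_one] at h1
  exact h1.trans_eq (by ring)

/-- Existence of an invariant probability measure. -/
theorem Regularizes.exists_invariant [Nonempty X] (h : H.Regularizes Q S a β) :
    ∃ π : Measure X, IsProbabilityMeasure π ∧ Kernel.Invariant κ π := by
  have := H.markov
  obtain ⟨x₀⟩ := ‹Nonempty X›
  have hβ := h.pos
  have hrep (k : ℕ) : ∃ ρ' : Measure X, Represents (Q ^ k) (Measure.dirac x₀) ρ' := by
    induction k with
    | zero =>
      exact ⟨Measure.dirac x₀, inferInstance, integrable_dirac' H.V_measurable.stronglyMeasurable
        (by simp), fun φ => rfl⟩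
    | succ k ih =>
      obtain ⟨ρ', h1, h2, h3⟩ := ih
      obtain ⟨ρ'', h4, h5, h6⟩ := h.represents ρ' h1 h2
      refine ⟨ρ'', h4, h5, fun φ => ?_⟩
      rw [h6, h3, pow_succ, Module.End.mul_apply]
  choose ρ hρ using hrep
  have hρP (k : ℕ) : IsProbabilityMeasure (ρ k) := (hρ k).1
  have hρφ (k : ℕ) (φ : wBounded V) : ∫ x, φ x ∂(ρ k) = (Q ^ k) φ x₀ := by
    rw [(hρ k).2.2, integral_dirac' _ _ (wBounded_measurable _).stronglyMeasurable]
  have hρA (k : ℕ) (A : Set X) (hA : MeasurableSet A) :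
      (ρ k).real A = (Q ^ k) (H.wInd hA) x₀ := by
    rw [← hρφ, ← integral_indicator_one hA]
    rfl
  have hosc (A : Set X) (hA : MeasurableSet A) (x y : X) :
      |H.wInd hA x - H.wInd hA y| ≤ 1 * (2 + β * (V x + V y)) := by
    have h1 : |H.wInd hA x - H.wInd hA y| ≤ 1 := by
      rw [wInd_apply, wInd_apply]
      by_cases hx : x ∈ A <;> by_cases hy : y ∈ A <;> simp [hx, hy]
    have := H.V_pos x
    have := H.V_pos y
    have : 0 < β * (V x + V y) := by positivity
    linarith
  -- Used twice: U = `Q` gives the Cauchy property of ρ_k(A), and U = `H.op` gives invariance of the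
  -- limit.
  have hmove (U : Module.End ℝ (wBounded V)) (hU : H.IsMarkovOp U) (k : ℕ) (A : Set X)
      (hA : MeasurableSet A) : |U ((Q ^ k) (H.wInd hA)) x₀ - (Q ^ k) (H.wInd hA) x₀|
        ≤ (2 + β * (V x₀ + U H.wV x₀)) * a ^ k := by
    refine (hU.abs_apply_sub_le (β := β) (r := a ^ k) (fun y => ?_)).trans_eq (by ring)
    rw [abs_sub_comm]
    exact (h.osc_pow_le (hosc A hA) k x₀ y).trans_eq (by ring)
  have hdist (A : Set X) (hA : MeasurableSet A) (k : ℕ) :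
      dist ((ρ k).real A) ((ρ (k + 1)).real A) ≤ (2 + β * (V x₀ + Q H.wV x₀)) * a ^ k := by
    rw [dist_comm, Real.dist_eq, hρA k A hA, hρA (k + 1) A hA, pow_succ', Module.End.mul_apply]
    exact hmove Q h.isMarkovOp k A hA
  have hex (A : Set X) : ∃ l, MeasurableSet A → Tendsto (fun k => (ρ k).real A) atTop (𝓝 l) := by
    by_cases hA : MeasurableSet A
    · obtain ⟨l, hl⟩ := cauchySeq_tendsto_of_complete
        (cauchySeq_of_le_geometric a _ h.lt_one (hdist A hA))
      exact ⟨l, fun _ => hl⟩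
    · exact ⟨0, fun h' => absurd h' hA⟩
  choose L hL using hex
  have hapow : Tendsto (fun k => a ^ k) atTop (𝓝 0) :=
    tendsto_pow_atTop_nhds_zero_of_lt_one h.nonneg h.lt_one
  set D := 2 + β * (V x₀ + Q H.wV x₀)
  have hgeo (k : ℕ) (A : Set X) (hA : MeasurableSet A) :
      |(ρ k).real A - L A| ≤ D * a ^ k / (1 - a) :=
    dist_le_of_le_geometric_of_tendsto a D h.lt_one (hdist A hA) (hL A hA) k
  have he : Tendsto (fun k => D * a ^ k / (1 - a)) atTop (𝓝 0) := by
    simpa using (hapow.const_mul D).div_const (1 - a)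
  obtain ⟨π, hπ, hπL⟩ := exists_measure_of_uniform_limit ρ L _ he hgeo
  refine ⟨π, hπ, ?_⟩
  rw [Kernel.Invariant]
  refine Measure.ext fun A hA => ?_
  have hreal : (π.bind κ).real A = ∫ x, H.op (H.wInd hA) x ∂π := by
    have h1 (x : X) : H.op (H.wInd hA) x = (κ x A).toReal := by
      rw [op_apply]
      exact integral_indicator_one hA
    simp_rw [h1]
    rw [integral_toReal (κ.measurable_coe hA).aemeasurable
      (ae_of_all _ fun x => measure_lt_top _ _), measureReal_def,
      Measure.bind_apply hA κ.aemeasurable]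
  have hop0 (x : X) : 0 ≤ H.op (H.wInd hA) x :=
    H.op_nonneg (fun y => Set.indicator_nonneg (fun _ _ => zero_le_one) y) x
  have hop1 (x : X) : H.op (H.wInd hA) x ≤ 1 := by
    have := H.op_nonneg (φ := H.wOne - H.wInd hA) (fun y => by
      have : A.indicator (fun _ => (1 : ℝ)) y ≤ 1 :=
        Set.indicator_le_self' (fun _ _ => zero_le_one) y
      simpa [wInd_apply] using this) x
    rw [map_sub, op_one] at this
    simpa using this
  have hlim1 : Tendsto (fun k => ∫ x, H.op (H.wInd hA) x ∂(ρ k)) atTop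
      (𝓝 (∫ x, H.op (H.wInd hA) x ∂π)) := by
    refine tendsto_iff_dist_tendsto_zero.2 (squeeze_zero (fun _ => dist_nonneg) (fun k => ?_) he)
    exact abs_integral_sub_le_of_measureReal_le
      (fun B hB => by rw [hπL B hB]; exact hgeo k B hB) (wBounded_measurable _) hop0 hop1
  have hlim2 : Tendsto (fun k => ∫ x, H.op (H.wInd hA) x ∂(ρ k)) atTop (𝓝 (L A)) := by
    have h1 : Tendsto (fun k => ∫ x, H.op (H.wInd hA) x ∂(ρ k) - (ρ k).real A) atTop (𝓝 0) := by
      refine squeeze_zero_norm (fun k => ?_)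
        (a := fun k => (2 + β * (V x₀ + H.op H.wV x₀)) * a ^ k) ?_
      -- Commutation moves κ outside Qᵏ, where the oscillation is already of order `a ^ k`.
      · rw [hρφ, hρA k A hA, ← Module.End.mul_apply, ← (h.commute.pow_right k).eq,
          Module.End.mul_apply]
        exact hmove H.op H.isMarkovOp_op k A hA
      · simpa using hapow.const_mul _
    simpa using h1.add (hL A hA)
  have hfin := tendsto_nhds_unique hlim1 hlim2
  rw [← hreal, ← hπL A hA] at hfin
  exact (measureReal_eq_measureReal_iff (measure_ne_top _ _) (measure_ne_top _ _)).1 hfin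

end DriftMinorization
end

/-! ### Moments and uniqueness of the invariant law; the Poisson equation. -/

noncomputable section

variable {X : Type*} [MeasurableSpace X]

lemma invariant_pow {κ : Kernel X X} {π : Measure X} (h : Kernel.Invariant κ π) (n : ℕ) :
    Kernel.Invariant (κ ^ n) π := by
  induction n with
  | zero => rw [pow_zero]; exact Measure.id_comp
  | succ n ih => rw [pow_succ]; exact ih.comp h

namespace DriftMinorization

variable {κ : Kernel X X} {K : Set X} {δ : ℝ} {m : ℕ} {ν : Measure X} {V : X → ℝ} {lam b : ℝ}

section invariant

variable (H : DriftMinorization κ K δ m ν V lam b) {π : Measure X} [IsProbabilityMeasure π]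
  (hπ : Kernel.Invariant κ π)
include H hπ

/-- Integrability of V cannot be presupposed, so V is truncated at N: invariance gives π(V ∧ N) ≤
π((lamʲV + C) ∧ N), then j → ∞ by domination and N → ∞ by monotonicity. -/
theorem lintegral_V_le_of_invariant :
    ∫⁻ x, ENNReal.ofReal (V x) ∂π ≤ ENNReal.ofReal (b / (1 - lam)) := by
  have := H.markov
  set C := b / (1 - lam)
  have hC : 0 ≤ C := H.const_nonneg
  have htrunc (N : ℕ) :
      ∫⁻ x, min (ENNReal.ofReal (V x)) N ∂π ≤ ENNReal.ofReal C := by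
    have hle (j : ℕ) : ∫⁻ x, min (ENNReal.ofReal (V x)) N ∂π
        ≤ ∫⁻ x, min (ENNReal.ofReal (lam ^ j * V x + C)) N ∂π := by
      have := isMarkovKernel_pow κ j
      have hm : Measurable fun x => min (ENNReal.ofReal (V x)) (N : ℝ≥0∞) :=
        H.V_measurable.ennreal_ofReal.min measurable_const
      calc ∫⁻ x, min (ENNReal.ofReal (V x)) N ∂π
          = ∫⁻ x, min (ENNReal.ofReal (V x)) N ∂(π.bind (κ ^ j)) := by
            rw [(invariant_pow hπ j).def]
        _ = ∫⁻ x, ∫⁻ y, min (ENNReal.ofReal (V y)) N ∂((κ ^ j) x) ∂π :=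
            Measure.lintegral_bind (κ ^ j).aemeasurable hm.aemeasurable
        _ ≤ _ := by
            refine lintegral_mono fun x => le_min ?_ ?_
            · exact (lintegral_mono fun y => min_le_left _ _).trans (H.lintegral_pow_le j x)
            · exact (lintegral_mono fun y => min_le_right _ _).trans (by simp)
    have hlim : Tendsto (fun j : ℕ => ∫⁻ x, min (ENNReal.ofReal (lam ^ j * V x + C)) N ∂π) atTop
        (𝓝 (∫⁻ _, min (ENNReal.ofReal C) N ∂π)) := by
      refine tendsto_lintegral_of_dominated_convergence (fun _ => (N : ℝ≥0∞)) (fun j => ?_)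
        (fun j => ae_of_all _ fun x => min_le_right _ _) (by simp) (ae_of_all _ fun x => ?_)
      · exact ((H.V_measurable.const_mul _).add_const _).ennreal_ofReal.min measurable_const
      · refine Tendsto.min (ENNReal.tendsto_ofReal ?_) tendsto_const_nhds
        simpa using ((tendsto_pow_atTop_nhds_zero_of_lt_one H.lam_pos.le
          H.lam_lt_one).mul_const (V x)).add_const C
    refine (ge_of_tendsto' hlim hle).trans ?_
    rw [lintegral_const, measure_univ, mul_one]
    exact min_le_left _ _
  have hsup (x : X) : ENNReal.ofReal (V x) = ⨆ N : ℕ, min (ENNReal.ofReal (V x)) (N : ℝ≥0∞) := by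
    refine le_antisymm ?_ (iSup_le fun N => min_le_left _ _)
    obtain ⟨N, hN⟩ := exists_nat_ge (V x)
    refine le_iSup_of_le N (le_min le_rfl ?_)
    rw [← ENNReal.ofReal_natCast]
    exact ENNReal.ofReal_le_ofReal hN
  rw [lintegral_congr hsup, lintegral_iSup (fun N => H.V_measurable.ennreal_ofReal.min measurable_const)]
  · exact iSup_le htrunc
  · intro M N hMN x
    exact min_le_min_left _ (by exact_mod_cast hMN)

lemma integrable_V_of_invariant : Integrable V π :=
  H.integrable_iff_lintegral.2
    ((H.lintegral_V_le_of_invariant hπ).trans_lt ENNReal.ofReal_lt_top)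

lemma integral_V_le_of_invariant : ∫ x, V x ∂π ≤ b / (1 - lam) := by
  rw [integral_eq_lintegral_of_nonneg_ae (ae_of_all _ fun y => (H.V_pos y).le)
    H.V_measurable.aestronglyMeasurable]
  exact ENNReal.toReal_le_of_le_ofReal H.const_nonneg (H.lintegral_V_le_of_invariant hπ)

lemma integral_op_of_invariant (φ : wBounded V) : ∫ x, H.op φ x ∂π = ∫ x, φ x ∂π := by
  rw [← H.integral_bind (H.integrable_V_of_invariant hπ), hπ.def]

end invariant

variable {H : DriftMinorization κ K δ m ν V lam b}
variable {Q S : Module.End ℝ (wBounded V)} {a β : ℝ}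

/-- An invariant law annihilates the range of 1 - κ, hence that of 1 - Q = (1 - κ)S. -/
lemma Regularizes.integral_of_invariant (h : H.Regularizes Q S a β) {π : Measure X}
    [IsProbabilityMeasure π] (hπ : Kernel.Invariant κ π) (φ : wBounded V) :
    ∫ x, Q φ x ∂π = ∫ x, φ x ∂π := by
  have hV := H.integrable_V_of_invariant hπ
  have h1 : φ - Q φ = S φ - H.op (S φ) := by
    have := congrArg (fun U : Module.End ℝ (wBounded V) => U φ) h.one_sub_eq
    simpa using this
  have h2 : ∫ x, (φ - Q φ) x ∂π = 0 := by
    rw [h1]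
    have : ∫ x, (S φ - H.op (S φ)) x ∂π = ∫ x, S φ x ∂π - ∫ x, H.op (S φ) x ∂π :=
      integral_sub (wBounded_integrable _ hV) (wBounded_integrable _ hV)
    rw [this, H.integral_op_of_invariant hπ, sub_self]
  have h3 : ∫ x, (φ - Q φ) x ∂π = ∫ x, φ x ∂π - ∫ x, Q φ x ∂π :=
    integral_sub (wBounded_integrable _ hV) (wBounded_integrable _ hV)
  linarith

lemma Regularizes.integral_pow_of_invariant (h : H.Regularizes Q S a β) {π : Measure X}
    [IsProbabilityMeasure π] (hπ : Kernel.Invariant κ π) (φ : wBounded V) (k : ℕ) :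
    ∫ x, (Q ^ k) φ x ∂π = ∫ x, φ x ∂π := by
  induction k with
  | zero => rfl
  | succ k ih => rw [pow_succ', Module.End.mul_apply, h.integral_of_invariant hπ, ih]

/-- Geometric convergence of the iterates of `Q` to the stationary expectation. -/
lemma Regularizes.exists_geometric_bound (h : H.Regularizes Q S a β) {π : Measure X}
    [IsProbabilityMeasure π] (hπ : Kernel.Invariant κ π) (φ : wBounded V) :
    ∃ D, 0 ≤ D ∧ ∀ k x, |(Q ^ k) φ x - ∫ y, φ y ∂π| ≤ D * V x * a ^ k := by
  have hV := H.integrable_V_of_invariant hπ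
  obtain ⟨M, hM0, hM⟩ := h.exists_osc_bound φ
  have hβ := h.pos
  have hI : 0 ≤ ∫ y, V y ∂π := integral_nonneg fun y => (H.V_pos y).le
  refine ⟨M * (2 + β * (1 + ∫ y, V y ∂π)), by positivity, fun k x => ?_⟩
  have ha := pow_nonneg h.nonneg k
  -- Replacing π(φ) by π(Qᵏφ) makes the difference an average over y of oscillations of Qᵏφ.
  rw [← h.integral_pow_of_invariant hπ φ k]
  have h1 : (Q ^ k) φ x - ∫ y, (Q ^ k) φ y ∂π = ∫ y, ((Q ^ k) φ x - (Q ^ k) φ y) ∂π := by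
    rw [integral_sub (integrable_const _) (wBounded_integrable _ hV)]
    simp
  have hint1 : Integrable (fun y => V x + V y) π := (integrable_const _).add hV
  have hint2 : Integrable (fun y => 2 + β * (V x + V y)) π :=
    (integrable_const _).add (hint1.const_mul _)
  rw [h1, ← Real.norm_eq_abs]
  refine (norm_integral_le_of_norm_le (hint2.const_mul (a ^ k * M))
    (ae_of_all _ fun y => h.osc_pow_le hM k x y)).trans ?_
  rw [integral_const_mul, integral_add (integrable_const _)
    (hint1.const_mul _), integral_const_mul,
    integral_add (integrable_const _) hV]
  simp only [integral_const, probReal_univ, one_smul]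
  have hx := H.one_le_V x
  have : 2 + β * (V x + ∫ y, V y ∂π) ≤ (2 + β * (1 + ∫ y, V y ∂π)) * V x := by
    nlinarith [mul_nonneg (mul_nonneg hβ.le hI) (sub_nonneg.2 hx)]
  calc _ ≤ a ^ k * M * ((2 + β * (1 + ∫ y, V y ∂π)) * V x) := by gcongr
    _ = _ := by ring

/-- The sequence Qᵏ1_A(x) does not involve the invariant law, yet converges to its value on A. -/
theorem Regularizes.invariant_unique (h : H.Regularizes Q S a β) {π σ : Measure X}
    [IsProbabilityMeasure π] [IsProbabilityMeasure σ] (hπ : Kernel.Invariant κ π)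
    (hσ : Kernel.Invariant κ σ) : σ = π := by
  refine Measure.ext fun A hA => ?_
  obtain ⟨x⟩ : Nonempty X := nonempty_of_isProbabilityMeasure π
  have hlim (ρ : Measure X) [IsProbabilityMeasure ρ] (hρ : Kernel.Invariant κ ρ) :
      Tendsto (fun k => (Q ^ k) (H.wInd hA) x) atTop (𝓝 (ρ.real A)) := by
    obtain ⟨D, _, hD⟩ := h.exists_geometric_bound hρ (H.wInd hA)
    have h1 : ∫ y, H.wInd hA y ∂ρ = ρ.real A := integral_indicator_one hA
    rw [h1] at hD
    refine tendsto_iff_dist_tendsto_zero.2 (squeeze_zero (fun _ => dist_nonneg)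
      (fun k => hD k x) ?_)
    simpa using (tendsto_pow_atTop_nhds_zero_of_lt_one h.nonneg h.lt_one).const_mul (D * V x)
  exact (measureReal_eq_measureReal_iff (measure_ne_top _ _) (measure_ne_top _ _)).1
    (tendsto_nhds_unique (hlim σ hσ) (hlim π hπ))

/-- Solvability of the Poisson equation of an operator that contracts oscillations. -/
lemma Regularizes.exists_poisson (h : H.Regularizes Q S a β) {π : Measure X}
    [IsProbabilityMeasure π] (hπ : Kernel.Invariant κ π) (φ : wBounded V) :
    ∃ g : wBounded V, g - Q g = φ - (∫ y, φ y ∂π) • H.wOne := by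
  obtain ⟨D, hD0, hD⟩ := h.exists_geometric_bound hπ φ
  set c := ∫ y, φ y ∂π
  have ha1 : 0 < 1 - a := by linarith [h.lt_one]
  let u (k : ℕ) : wBounded V := (Q ^ k) φ - c • H.wOne
  have hu (k : ℕ) (x : X) : |u k x| ≤ D * V x * a ^ k := by simpa [u] using hD k x
  have hQu (k : ℕ) : Q (u k) = u (k + 1) := by
    simp [u, h.isMarkovOp.map_one, pow_succ']
  -- Partial sums of the Neumann series ∑ Qᵏ(φ - π(φ)), which converges geometrically in the V-norm.
  let G (N : ℕ) : wBounded V := ∑ k ∈ Finset.range N, u k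
  have hGx (N : ℕ) (x : X) : G N x = ∑ k ∈ Finset.range N, u k x := by
    simp [G, Finset.sum_apply]
  have hsum (x : X) : Summable fun k => u k x :=
    Summable.of_norm_bounded ((summable_geometric_of_lt_one h.nonneg h.lt_one).mul_left _)
      (fun k => hu k x)
  have hGlim (x : X) : Tendsto (fun N => G N x) atTop (𝓝 (∑' k, u k x)) := by
    simp_rw [hGx]
    exact (hsum x).hasSum.tendsto_sum_nat
  have hdist (x : X) (N : ℕ) : |G N x - ∑' k, u k x| ≤ D * V x * a ^ N / (1 - a) := by
    refine dist_le_of_le_geometric_of_tendsto a (D * V x) h.lt_one (fun k => ?_) (hGlim x) N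
    rw [dist_comm, Real.dist_eq, hGx, hGx, Finset.sum_range_succ, add_sub_cancel_left]
    exact hu k x
  let g : wBounded V := ⟨fun x => ∑' k, u k x,
    measurable_of_tendsto_metrizable (fun N => wBounded_measurable (G N))
      (tendsto_pi_nhds.2 hGlim), D / (1 - a), fun x => by
        have := hdist x 0
        simp only [hGx, Finset.range_zero, Finset.sum_empty, zero_sub, abs_neg, pow_zero,
          mul_one] at this
        exact this.trans_eq (by ring)⟩
  refine ⟨g, ?_⟩
  ext x
  -- The limit passes through Q by positivity, from |G_N - g| ≤ const · aᴺ V.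
  have hQlim : Tendsto (fun N => Q (G N) x) atTop (𝓝 (Q g x)) := by
    refine tendsto_iff_dist_tendsto_zero.2 (squeeze_zero (fun _ => dist_nonneg)
      (g := fun N => D / (1 - a) * Q H.wV x * a ^ N) (fun N => ?_) ?_)
    · have := h.isMarkovOp.abs_sub_le (ψ := G N - g) (W := (D / (1 - a) * a ^ N) • H.wV)
        (fun y => (hdist y N).trans_eq (by
          simp only [Submodule.coe_smul, Pi.smul_apply, wV_apply, smul_eq_mul]; ring)) x
      simp only [map_sub, map_smul, Submodule.coe_sub, Submodule.coe_smul, Pi.sub_apply,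
        Pi.smul_apply, smul_eq_mul] at this
      exact this.trans_eq (by ring)
    · simpa using (tendsto_pow_atTop_nhds_zero_of_lt_one h.nonneg h.lt_one).const_mul
        (D / (1 - a) * Q H.wV x)
  have hstep (N : ℕ) : Q (G N) x = G (N + 1) x - u 0 x := by
    simp only [G, map_sum, hQu, Finset.sum_range_succ', Submodule.coe_add, Pi.add_apply,
      add_sub_cancel_right]
  have hlim2 : Tendsto (fun N => Q (G N) x) atTop (𝓝 (g x - u 0 x)) := by
    simp_rw [hstep]
    exact ((tendsto_add_atTop_iff_nat 1).2 (hGlim x)).sub_const _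
  have hfin := tendsto_nhds_unique hQlim hlim2
  simp only [Submodule.coe_sub, Pi.sub_apply, hfin, sub_sub_cancel]
  simp [u]

variable (H)
include H

/-- Existence and uniqueness of the stationary distribution. -/
theorem existsUnique_stationary [Nonempty X] : ∃! π : Measure X, IsStationary κ π := by
  obtain ⟨Q, S, a, β, h⟩ := H.exists_regularizes
  obtain ⟨π, hπ1, hπ2⟩ := h.exists_invariant
  refine ⟨π, ⟨hπ1, hπ2⟩, fun σ hσ => ?_⟩
  have := hσ.1
  exact h.invariant_unique hπ2 hσ.2

/-- Solvability of the Poisson equation. -/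
theorem exists_poisson {π : Measure X} [IsProbabilityMeasure π] (hπ : Kernel.Invariant κ π)
    {φ : X → ℝ} (hφ : φ ∈ wBounded V) :
    ∃ g ∈ wBounded V, ∀ x, g x - ∫ y, g y ∂(κ x) = φ x - ∫ y, φ y ∂π := by
  have : Nonempty X := nonempty_of_isProbabilityMeasure π
  obtain ⟨Q, S, a, β, h⟩ := H.exists_regularizes
  obtain ⟨g, hg⟩ := h.exists_poisson hπ ⟨φ, hφ⟩
  have h1 : g - Q g = S g - H.op (S g) := by
    have := congrArg (fun U : Module.End ℝ (wBounded V) => U g) h.one_sub_eq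
    simpa using this
  -- If g solves the equation for Q, then (1 - κ)Sg = (1 - Q)g.
  refine ⟨S g, (S g).2, fun x => ?_⟩
  rw [h1] at hg
  have := congrFun (congrArg Subtype.val hg) x
  simpa [op_apply] using this

end DriftMinorization
end

/-! ### Square-root drift, operator norms and the derivative of stationary expectations. -/

noncomputable section

variable {X : Type*} [MeasurableSpace X]

lemma mem_wBounded_of_sqrt {V : X → ℝ} (hV : ∀ x, 1 ≤ V x) {φ : X → ℝ}
    (hφ : φ ∈ wBounded fun x => √(V x)) : φ ∈ wBounded V := by
  obtain ⟨M, hM0, hM⟩ := wBounded_exists_nonneg_bound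
    (fun x => Real.one_le_sqrt.2 (hV x)) ⟨φ, hφ⟩
  refine ⟨hφ.1, M, fun x => (hM x).trans (mul_le_mul_of_nonneg_left ?_ hM0)⟩
  exact Real.sqrt_le_iff.2 ⟨zero_le_one.trans (hV x), by nlinarith [hV x]⟩

/-- The square root of a drift function satisfies a drift condition. -/
lemma DriftMinorization.sqrt {κ : Kernel X X} {K : Set X} {δ : ℝ} {m : ℕ} {ν : Measure X}
    {V : X → ℝ} {lam b : ℝ} (H : DriftMinorization κ K δ m ν V lam b) :
    DriftMinorization κ K δ m ν (fun x => √(V x)) (√lam) (√b) where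
  markov := H.markov
  small_measurable := H.small_measurable
  delta_pos := H.delta_pos
  one_le_m := H.one_le_m
  prob := H.prob
  small := H.small
  V_measurable := H.V_measurable.sqrt
  one_le_V x := Real.one_le_sqrt.2 (H.one_le_V x)
  lam_pos := Real.sqrt_pos.2 H.lam_pos
  lam_lt_one := by rw [Real.sqrt_lt' one_pos]; simpa using H.lam_lt_one
  b_pos := Real.sqrt_pos.2 H.b_pos
  drift x := by
    have := H.markov
    set q := lam * V x + K.indicator (fun _ => b) x
    have hi : 0 ≤ K.indicator (fun _ => b) x := Set.indicator_nonneg (fun _ _ => H.b_pos.le) x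
    have hq : 0 < q := by have := mul_pos H.lam_pos (H.V_pos x); positivity
    have hc : 0 < √q := Real.sqrt_pos.2 hq
    have hVint := H.integrable_V_kernel x
    -- The tangent line of the square root at `q`; integrating it replaces Jensen's inequality.
    have hle (y : X) : √(V y) ≤ V y * (2 * √q)⁻¹ + √q / 2 := by
      have h1 : √(V y) * √(V y) = V y := Real.mul_self_sqrt (H.V_pos y).le
      have h2 : V y * (2 * √q)⁻¹ + √q / 2 = (V y + √q * √q) / (2 * √q) := by field_simp
      rw [h2, le_div_iff₀ (by positivity)]
      nlinarith [sq_nonneg (√(V y) - √q)]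
    have hint : Integrable (fun y => V y * (2 * √q)⁻¹ + √q / 2) (κ x) :=
      (hVint.mul_const _).add (integrable_const _)
    have hsint : Integrable (fun y => √(V y)) (κ x) :=
      hint.mono' H.V_measurable.sqrt.aestronglyMeasurable (ae_of_all _ fun y => by
        rw [Real.norm_eq_abs, abs_of_nonneg (Real.sqrt_nonneg _)]; exact hle y)
    rw [← ofReal_integral_eq_lintegral_ofReal hsint (ae_of_all _ fun y => Real.sqrt_nonneg _)]
    refine ENNReal.ofReal_le_ofReal ?_
    calc ∫ y, √(V y) ∂(κ x) ≤ ∫ y, (V y * (2 * √q)⁻¹ + √q / 2) ∂(κ x) :=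
          integral_mono hsint hint hle
      _ = (∫ y, V y ∂(κ x)) * (2 * √q)⁻¹ + √q / 2 := by
          rw [integral_add (hVint.mul_const _) (integrable_const _), integral_mul_const]
          simp
      _ ≤ q * (2 * √q)⁻¹ + √q / 2 := by
          gcongr
          exact H.integral_le x
      _ = √q := by
          have : √q * √q = q := Real.mul_self_sqrt hq.le
          field_simp
          linarith
      _ ≤ √lam * √(V x) + K.indicator (fun _ => √b) x := by
          have h1 : 0 ≤ √lam * √(V x) := by positivity
          have h2 : (√lam * √(V x)) ^ 2 = lam * V x := by
            rw [mul_pow, Real.sq_sqrt H.lam_pos.le, Real.sq_sqrt (H.V_pos x).le]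
          rw [Real.sqrt_le_left]
          · by_cases hx : x ∈ K
            · simp only [q, hx, Set.indicator_of_mem]
              nlinarith [Real.sq_sqrt H.b_pos.le, Real.sqrt_nonneg b,
                mul_nonneg h1 (Real.sqrt_nonneg b)]
            · simp [q, hx, h2]
          · exact add_nonneg h1 (Set.indicator_nonneg (fun _ _ => Real.sqrt_nonneg _) x)

/-- A finite weighted norm yields a pointwise bound. -/
lemma exists_bound_of_wnorm_lt_top {Y : Type*} {w : Y → ℝ} (hw : ∀ x, 1 ≤ w x) {F : Y → ℝ≥0∞}
    (h : wnorm w F < ∞) : ∃ M, 0 ≤ M ∧ ∀ x, F x ≤ ENNReal.ofReal (M * w x) := by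
  refine ⟨(wnorm w F).toReal, ENNReal.toReal_nonneg, fun x => ?_⟩
  have hwx : 0 < w x := zero_lt_one.trans_le (hw x)
  rw [ENNReal.ofReal_mul ENNReal.toReal_nonneg, ENNReal.ofReal_toReal h.ne,
    ← ENNReal.div_le_iff_le_mul (Or.inl (ENNReal.ofReal_pos.2 hwx).ne')
      (Or.inl ENNReal.ofReal_ne_top)]
  exact le_iSup (fun x => F x / ENNReal.ofReal (w x)) x

/-- The operator norm controls the action on all functions dominated by a multiple of `V`. -/
lemma abs_apply_le_of_opNorm {V : X → ℝ} (hV : ∀ x, 1 ≤ V x) {T : (X → ℝ) → X → ℝ}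
    (hT : ∀ (c : ℝ) u x, T (fun y => c * u y) x = c * T u x) (hfin : opNorm V T < ∞)
    {u : X → ℝ} (hu : Measurable u) {M : ℝ} (hM : ∀ x, |u x| ≤ M * V x) (x : X) :
    |T u x| ≤ M * (opNorm V T).toReal * V x := by
  have hVpos (x : X) : 0 < V x := zero_lt_one.trans_le (hV x)
  have hM0 : 0 ≤ M := nonneg_of_mul_nonneg_left ((abs_nonneg _).trans (hM x)) (hVpos x)
  set s := wnorm V fun x => ‖u x‖ₑ
  have hsM : s ≤ ENNReal.ofReal M := by
    refine iSup_le fun y => ENNReal.div_le_of_le_mul ?_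
    rw [← ENNReal.ofReal_mul hM0]
    change ‖u y‖ₑ ≤ _
    rw [← ofReal_norm]
    exact ENNReal.ofReal_le_ofReal (hM y)
  have hsfin : s ≠ ∞ := (hsM.trans_lt ENNReal.ofReal_lt_top).ne
  -- The operator norm tests only functions of norm exactly 1, so u = 0 needs homogeneity and other
  -- u are normalized.
  rcases eq_or_ne s 0 with h0 | h0
  · have hu0 : u = fun y => 0 * u y := by
      funext y
      have h1 := le_iSup (fun x => ‖u x‖ₑ / ENNReal.ofReal (V x)) y
      change _ ≤ s at h1
      rw [h0, nonpos_iff_eq_zero, ENNReal.div_eq_zero_iff] at h1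
      simpa using h1
    rw [hu0, hT, zero_mul, abs_zero]
    exact mul_nonneg (mul_nonneg hM0 ENNReal.toReal_nonneg) (hVpos x).le
  · have hspos : 0 < s.toReal := ENNReal.toReal_pos h0 hsfin
    have hv1 : wnorm V (fun x => ‖s.toReal⁻¹ * u x‖ₑ) = 1 := by
      have hn : ‖s.toReal⁻¹‖ₑ = s⁻¹ := by
        rw [← ofReal_norm, Real.norm_of_nonneg (inv_nonneg.2 hspos.le),
          ENNReal.ofReal_inv_of_pos hspos, ENNReal.ofReal_toReal hsfin]
      have : wnorm V (fun x => ‖s.toReal⁻¹ * u x‖ₑ)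
          = s⁻¹ * ⨆ x, ‖u x‖ₑ / ENNReal.ofReal (V x) := by
        rw [wnorm, ENNReal.mul_iSup]
        refine iSup_congr fun y => ?_
        rw [enorm_mul, hn, mul_div_assoc]
      exact this.trans (ENNReal.inv_mul_cancel h0 hsfin)
    have h1 : wnorm V (fun x => ‖T (fun y => s.toReal⁻¹ * u y) x‖ₑ) ≤ opNorm V T :=
      le_iSup (fun u : {u : X → ℝ // Measurable u ∧ wnorm V (fun x => ‖u x‖ₑ) = 1} =>
        wnorm V (fun x => ‖T u.1 x‖ₑ)) ⟨_, hu.const_mul _, hv1⟩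
    have h2 : ‖T (fun y => s.toReal⁻¹ * u y) x‖ₑ ≤ opNorm V T * ENNReal.ofReal (V x) := by
      rw [← ENNReal.div_le_iff_le_mul (Or.inl (ENNReal.ofReal_pos.2 (hVpos x)).ne')
        (Or.inl ENNReal.ofReal_ne_top)]
      exact (le_iSup (fun x => ‖T (fun y => s.toReal⁻¹ * u y) x‖ₑ / ENNReal.ofReal (V x)) x).trans h1
    have h3 : |T (fun y => s.toReal⁻¹ * u y) x| ≤ (opNorm V T).toReal * V x := by
      have := ENNReal.toReal_mono (ENNReal.mul_ne_top hfin.ne ENNReal.ofReal_ne_top) h2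
      rwa [toReal_enorm, ENNReal.toReal_mul, ENNReal.toReal_ofReal (hVpos x).le] at this
    rw [hT, abs_mul, abs_of_pos (inv_pos.2 hspos), inv_mul_le_iff₀ hspos] at h3
    calc |T u x| ≤ s.toReal * ((opNorm V T).toReal * V x) := h3
      _ ≤ M * ((opNorm V T).toReal * V x) := by
          refine mul_le_mul_of_nonneg_right (ENNReal.toReal_le_of_le_ofReal hM0 hsM) ?_
          exact mul_nonneg ENNReal.toReal_nonneg (hVpos x).le
      _ = _ := by ring

namespace StandingAssumption

variable {d : ℕ} {Θ : Set (Fin d → ℝ)} {P : (Fin d → ℝ) → Kernel X X}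
  {p : (Fin d → ℝ) → X → X → ℝ} {θ₀ : Fin d → ℝ} {ε : ℝ} {K : Set X} {δ : ℝ} {m : ℕ}
  {ν : Measure X} {V : X → ℝ} {lam b : ℝ} {f : X → ℝ}

lemma derivKernel_const_mul (i : Fin d) (c : ℝ) (u : X → ℝ) (x : X) :
    derivKernel P p θ₀ i (fun y => c * u y) x = c * derivKernel P p θ₀ i u x := by
  simp only [derivKernel, mul_assoc, integral_const_mul]

lemma diffQuot_sub_const_mul (i : Fin d) (h c : ℝ) (u : X → ℝ) (x : X) :
    diffQuot P θ₀ i h (fun y => c * u y) x - derivKernel P p θ₀ i (fun y => c * u y) x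
      = c * (diffQuot P θ₀ i h u x - derivKernel P p θ₀ i u x) := by
  rw [derivKernel_const_mul]
  simp only [diffQuot, integral_const_mul]
  ring

variable (hA : StandingAssumption Θ P p θ₀ ε K δ m ν V lam b f)
include hA

lemma mem_box : θ₀ ∈ box Θ θ₀ ε := ⟨hA.mem, fun i => by simpa using hA.eps_pos⟩

lemma eventually_mem_box (i : Fin d) : ∀ᶠ h : ℝ in 𝓝 0, θ₀ + h • Pi.single i 1 ∈ box Θ θ₀ ε := by
  filter_upwards [hA.axes i, Metric.ball_mem_nhds (0 : ℝ) hA.eps_pos] with h h1 h2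
  refine ⟨h1, fun j => ?_⟩
  have h3 : |h| < ε := by simpa using h2
  rcases eq_or_ne j i with rfl | hj
  · simpa using h3
  · simpa [hj] using hA.eps_pos

/-- The sign of `b` is not prescribed; enlarging it to `max b 1` weakens the drift bound and makes
the constant positive. -/
lemma driftMinorization {θ : Fin d → ℝ} (hθ : θ ∈ box Θ θ₀ ε) :
    DriftMinorization (P θ) K δ m ν V lam (max b 1) where
  markov := hA.markov θ hθ.1
  small_measurable := hA.small_measurable
  delta_pos := hA.delta_pos
  one_le_m := hA.one_le_m
  prob := hA.prob
  small := hA.small θ hθ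
  V_measurable := hA.V_measurable
  one_le_V := hA.one_le_V
  lam_pos := hA.lam_pos
  lam_lt_one := hA.lam_lt_one
  b_pos := lt_max_of_lt_right one_pos
  drift x := by
    refine (hA.drift θ hθ x).trans (ENNReal.ofReal_le_ofReal ?_)
    gcongr
    exact le_max_left _ _

lemma f_mem : f ∈ wBounded fun x => √(V x) := by
  obtain ⟨M, hM0, hM⟩ := exists_bound_of_wnorm_lt_top
    (fun x => Real.one_le_sqrt.2 (hA.one_le_V x)) hA.f_bounded
  refine ⟨hA.f_measurable, M, fun x => ?_⟩
  have := hM x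
  rw [← ofReal_norm, ENNReal.ofReal_le_ofReal_iff (by positivity)] at this
  exact this

lemma stationary_spec [Nonempty X] {θ : Fin d → ℝ} (hθ : θ ∈ box Θ θ₀ ε) :
    IsStationary (P θ) (stationary (P θ)) := by
  have h := (hA.driftMinorization hθ).existsUnique_stationary.exists
  rw [stationary, dif_pos h]
  exact h.choose_spec

/-- The partial derivatives of the density are jointly measurable. -/
lemma measurable_score (i : Fin d) :
    Measurable (Function.uncurry fun x y => partialDeriv i (fun θ => p θ x y) θ₀) := by
  have ht : Tendsto (fun n : ℕ => 1 / ((n : ℝ) + 1)) atTop (𝓝[≠] 0) :=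
    tendsto_nhdsWithin_iff.2 ⟨tendsto_one_div_add_atTop_nhds_zero_nat,
      Eventually.of_forall fun n => by
        have : (0 : ℝ) < 1 / ((n : ℝ) + 1) := by positivity
        exact this.ne'⟩
  -- The index shift by N keeps every θ₀ + t_n e_i in the box, where the densities are measurable.
  obtain ⟨N, hN⟩ := eventually_atTop.1
    ((ht.mono_right nhdsWithin_le_nhds).eventually (hA.eventually_mem_box i))
  set t : ℕ → ℝ := fun n => 1 / (((n + N : ℕ) : ℝ) + 1)
  have ht' : Tendsto t atTop (𝓝[≠] 0) := ht.comp (tendsto_add_atTop_nat N)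
  refine measurable_of_tendsto_metrizable (f := fun n z =>
    (t n)⁻¹ • (Function.uncurry (p (θ₀ + t n • Pi.single i 1)) z - Function.uncurry (p θ₀) z))
    (fun n => ?_) (tendsto_pi_nhds.2 fun z => ?_)
  · exact ((hA.density_measurable _ (hN (n + N) (by omega))).sub
      (hA.density_measurable _ hA.mem_box)).const_smul (t n)⁻¹
  · exact (hA.density_differentiable z.1 z.2 i).hasLineDerivAt.tendsto_slope_zero.comp ht'

lemma derivKernel_mem (i : Fin d) {u : X → ℝ} (hu : u ∈ wBounded V) :
    derivKernel P p θ₀ i u ∈ wBounded V := by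
  have := hA.markov θ₀ hA.mem
  obtain ⟨M, hM⟩ := hu.2
  refine ⟨?_, M * (opNorm V (derivKernel P p θ₀ i)).toReal, fun x =>
    abs_apply_le_of_opNorm hA.one_le_V (derivKernel_const_mul i) (hA.deriv_bounded i) hu.1 hM x⟩
  have h1 : Measurable (Function.uncurry fun x y =>
      u y * partialDeriv i (fun θ => p θ x y) θ₀) :=
    (hu.1.comp measurable_snd).mul (hA.measurable_score i)
  exact (h1.stronglyMeasurable.integral_kernel_prod_right (κ := P θ₀)).measurable

/-- The distance between difference quotients and the derivative, on functions dominated by a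
multiple of `V`. -/
lemma exists_diffQuot_modulus (i : Fin d) : ∃ e : ℝ → ℝ, Tendsto e (𝓝[≠] 0) (𝓝 0) ∧
    ∀ᶠ h in 𝓝[≠] (0 : ℝ), ∀ u : X → ℝ, Measurable u → ∀ M, (∀ x, |u x| ≤ M * V x) →
      ∀ x, |diffQuot P θ₀ i h u x - derivKernel P p θ₀ i u x| ≤ M * e h * V x := by
  refine ⟨fun h => (opNorm V (fun u x =>
    diffQuot P θ₀ i h u x - derivKernel P p θ₀ i u x)).toReal, ?_, ?_⟩
  · exact (ENNReal.tendsto_toReal ENNReal.zero_ne_top).comp (hA.deriv_limit i)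
  · filter_upwards [(hA.deriv_limit i).eventually (gt_mem_nhds ENNReal.zero_lt_top)]
      with h hh u hu M hM x
    exact abs_apply_le_of_opNorm hA.one_le_V (diffQuot_sub_const_mul i h) hh hu hM x

/-- The score has mean zero. -/
lemma integral_score_eq_zero (i : Fin d) (x : X) :
    ∫ y, partialDeriv i (fun θ => p θ x y) θ₀ ∂(P θ₀ x) = 0 := by
  have := hA.markov θ₀ hA.mem
  obtain ⟨e, he, hbound⟩ := hA.exists_diffQuot_modulus i
  have h1 : ∀ᶠ h in 𝓝[≠] (0 : ℝ), |derivKernel P p θ₀ i (fun _ => 1) x| ≤ e h * V x := by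
    filter_upwards [hbound, nhdsWithin_le_nhds (hA.eventually_mem_box i)] with h hh hb
    have := hA.markov _ hb.1
    have h2 := hh (fun _ => 1) measurable_const 1 (fun x => by simpa using hA.one_le_V x) x
    -- Both kernels have total mass 1.
    have h3 : diffQuot P θ₀ i h (fun _ => 1) x = 0 := by simp [diffQuot]
    rwa [h3, zero_sub, abs_neg, one_mul] at h2
  have h2 : Tendsto (fun h => e h * V x) (𝓝[≠] 0) (𝓝 0) := by simpa using he.mul_const (V x)
  have h3 := abs_nonpos_iff.1 (ge_of_tendsto h2 h1)
  simpa [derivKernel] using h3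

lemma integrable_stationary [Nonempty X] {θ : Fin d → ℝ} (hθ : θ ∈ box Θ θ₀ ε) {u : X → ℝ}
    (hu : u ∈ wBounded V) : Integrable u (stationary (P θ)) := by
  have h := hA.stationary_spec hθ
  have := h.1
  exact wBounded_integrable ⟨u, hu⟩ ((hA.driftMinorization hθ).integrable_V_of_invariant h.2)

/-- The bound does not depend on θ, so V-norm convergence survives integration against the varying
π(θ). -/
lemma abs_steadyState_le [Nonempty X] {θ : Fin d → ℝ} (hθ : θ ∈ box Θ θ₀ ε) {u : X → ℝ} {M : ℝ}
    (hM0 : 0 ≤ M) (hM : ∀ x, |u x| ≤ M * V x) :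
    |steadyState P u θ| ≤ M * (max b 1 / (1 - lam)) := by
  have H := hA.driftMinorization hθ
  have h := hA.stationary_spec hθ
  have := h.1
  have hV := H.integrable_V_of_invariant h.2
  rw [steadyState, ← Real.norm_eq_abs]
  refine (norm_integral_le_of_norm_le (hV.const_mul M) (ae_of_all _ hM)).trans ?_
  rw [integral_const_mul]
  exact mul_le_mul_of_nonneg_left (H.integral_V_le_of_invariant h.2) hM0

/-- Perturbation identity for stationary expectations. -/
lemma steadyState_sub [Nonempty X] {i : Fin d} {t : ℝ}
    (hθ : θ₀ + t • Pi.single i 1 ∈ box Θ θ₀ ε) {u g : X → ℝ} (hu : u ∈ wBounded V)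
    (hg : g ∈ wBounded V)
    (hP : ∀ x, g x - ∫ y, g y ∂(P θ₀ x) = u x - steadyState P u θ₀) :
    t⁻¹ * (steadyState P u (θ₀ + t • Pi.single i 1) - steadyState P u θ₀)
      = steadyState P (diffQuot P θ₀ i t g) (θ₀ + t • Pi.single i 1) := by
  set θ := θ₀ + t • Pi.single i 1 with hθdef
  have H := hA.driftMinorization hθ
  have H0 := hA.driftMinorization hA.mem_box
  have h := hA.stationary_spec hθ
  have := h.1
  have hint {v : X → ℝ} (hv : v ∈ wBounded V) : Integrable v (stationary (P θ)) :=
    hA.integrable_stationary hθ hv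
  have h1 : steadyState P u θ - steadyState P u θ₀
      = ∫ x, (u x - steadyState P u θ₀) ∂(stationary (P θ)) := by
    rw [integral_sub (hint hu) (integrable_const _)]
    simp [steadyState]
  have h2 : ∫ x, (u x - steadyState P u θ₀) ∂(stationary (P θ))
      = ∫ x, g x ∂(stationary (P θ)) - ∫ x, ∫ y, g y ∂(P θ₀ x) ∂(stationary (P θ)) := by
    rw [← integral_sub (hint hg) (hint (H0.integral_mem hg))]
    exact integral_congr_ae (ae_of_all _ fun x => (hP x).symm)
  -- Invariance under `P θ` turns π(θ)(g - P(θ₀)g) into π(θ)(P(θ) - P(θ₀))g.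
  have h3 : ∫ x, g x ∂(stationary (P θ)) = ∫ x, ∫ y, g y ∂(P θ x) ∂(stationary (P θ)) :=
    (H.integral_op_of_invariant h.2 ⟨g, hg⟩).symm
  rw [h1, h2, h3, ← integral_sub (hint (H.integral_mem hg)) (hint (H0.integral_mem hg)),
    ← integral_const_mul, steadyState]
  refine integral_congr_ae (ae_of_all _ fun x => ?_)
  simp only [diffQuot, ← hθdef]
  ring

lemma diffQuot_mem {i : Fin d} {t : ℝ} (hθ : θ₀ + t • Pi.single i 1 ∈ box Θ θ₀ ε) {g : X → ℝ}
    (hg : g ∈ wBounded V) : diffQuot P θ₀ i t g ∈ wBounded V := by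
  have h1 := (wBounded V).smul_mem t⁻¹ ((wBounded V).sub_mem
    ((hA.driftMinorization hθ).integral_mem hg)
    ((hA.driftMinorization hA.mem_box).integral_mem hg))
  convert h1 using 1
  funext x
  simp [diffQuot, div_eq_inv_mul]

/-- Stationary expectations of difference quotients are close to those of the derivative. -/
lemma tendsto_steadyState_diffQuot_sub [Nonempty X] (i : Fin d) {g : X → ℝ}
    (hg : g ∈ wBounded V) :
    Tendsto (fun t : ℝ => steadyState P (diffQuot P θ₀ i t g) (θ₀ + t • Pi.single i 1)
      - steadyState P (derivKernel P p θ₀ i g) (θ₀ + t • Pi.single i 1)) (𝓝[≠] 0) (𝓝 0) := by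
  obtain ⟨e, he, hbound⟩ := hA.exists_diffQuot_modulus i
  obtain ⟨M, hM0, hM⟩ := wBounded_exists_nonneg_bound hA.one_le_V ⟨g, hg⟩
  set C := max b 1 / (1 - lam)
  refine squeeze_zero_norm' (a := fun t => M * |e t| * C) ?_ ?_
  · filter_upwards [hbound, nhdsWithin_le_nhds (hA.eventually_mem_box i)] with t ht hb
    have h1 : steadyState P (diffQuot P θ₀ i t g) (θ₀ + t • Pi.single i 1)
        - steadyState P (derivKernel P p θ₀ i g) (θ₀ + t • Pi.single i 1)
        = steadyState P (fun x => diffQuot P θ₀ i t g x - derivKernel P p θ₀ i g x)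
          (θ₀ + t • Pi.single i 1) :=
      (integral_sub (hA.integrable_stationary hb (hA.diffQuot_mem hb hg))
        (hA.integrable_stationary hb (hA.derivKernel_mem i hg))).symm
    rw [h1, Real.norm_eq_abs]
    refine hA.abs_steadyState_le hb (by positivity) fun x => (ht g hg.1 M hM x).trans ?_
    have := hA.one_le_V x
    gcongr
    exact le_abs_self _
  · simpa using (he.abs.const_mul M).mul_const C

/-- Stationary expectations are continuous along the coordinate axes. -/
lemma tendsto_steadyState [Nonempty X] (i : Fin d) {u : X → ℝ} (hu : u ∈ wBounded V) :
    Tendsto (fun t : ℝ => steadyState P u (θ₀ + t • Pi.single i 1)) (𝓝[≠] 0)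
      (𝓝 (steadyState P u θ₀)) := by
  have hst := hA.stationary_spec hA.mem_box
  have := hst.1
  obtain ⟨g, hg, hP⟩ := (hA.driftMinorization hA.mem_box).exists_poisson hst.2 hu
  obtain ⟨M, hM0, hM⟩ := wBounded_exists_nonneg_bound hA.one_le_V ⟨_, hA.derivKernel_mem i hg⟩
  have hdiff := hA.tendsto_steadyState_diffQuot_sub i hg
  set C := max b 1 / (1 - lam)
  have hid : Tendsto (fun t : ℝ => t) (𝓝[≠] 0) (𝓝 0) := nhdsWithin_le_nhds
  have h0 : Tendsto (fun t : ℝ => steadyState P u (θ₀ + t • Pi.single i 1) - steadyState P u θ₀)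
      (𝓝[≠] 0) (𝓝 0) := by
    -- The increment is t times a stationary expectation of a difference quotient, and the latter
    -- stays bounded.
    refine squeeze_zero_norm' (a := fun t => |t| *
      (|steadyState P (diffQuot P θ₀ i t g) (θ₀ + t • Pi.single i 1)
        - steadyState P (derivKernel P p θ₀ i g) (θ₀ + t • Pi.single i 1)| + M * C)) ?_ ?_
    · filter_upwards [self_mem_nhdsWithin, nhdsWithin_le_nhds (hA.eventually_mem_box i)]
        with t ht hb
      have h1 := hA.steadyState_sub hb hu hg hP
      have h2 := hA.abs_steadyState_le hb hM0 hM
      rw [inv_mul_eq_iff_eq_mul₀ ht] at h1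
      rw [Real.norm_eq_abs, h1, abs_mul]
      refine mul_le_mul_of_nonneg_left ?_ (abs_nonneg t)
      refine le_trans ?_ (add_le_add_right h2 _)
      rw [← sub_le_iff_le_add]
      exact abs_sub_abs_le_abs_sub _ _
    · simpa using hid.abs.mul (hdiff.abs.add_const (M * C))
  simpa using h0.add_const (steadyState P u θ₀)

/-- The partial derivative of the steady-state expectation. -/
theorem hasLineDerivAt_steadyState [Nonempty X] (i : Fin d) {u g : X → ℝ} (hu : u ∈ wBounded V)
    (hg : g ∈ wBounded V)
    (hP : ∀ x, g x - ∫ y, g y ∂(P θ₀ x) = u x - steadyState P u θ₀) :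
    HasLineDerivAt ℝ (steadyState P u) (steadyState P (derivKernel P p θ₀ i g) θ₀) θ₀
      (Pi.single i 1) := by
  rw [hasLineDerivAt_iff_tendsto_slope_zero]
  -- The difference quotient becomes the derivative under the moving law; then the law moves to
  -- π(θ₀).
  have h1 := (hA.tendsto_steadyState_diffQuot_sub i hg).add
    (hA.tendsto_steadyState i (hA.derivKernel_mem i hg))
  rw [zero_add] at h1
  refine h1.congr' ?_
  filter_upwards [self_mem_nhdsWithin, nhdsWithin_le_nhds (hA.eventually_mem_box i)] with t _ hb
  rw [sub_add_cancel, smul_eq_mul]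
  exact (hA.steadyState_sub hb hu hg hP).symm

end StandingAssumption
end

/-! ### The chain as a process: pair laws, martingale increments, ergodic averages. -/

noncomputable section

variable {X Ω : Type*} [MeasurableSpace X]

/-- The σ-algebra generated by the process up to time `n`. -/
abbrev history (Φ : ℕ → Ω → X) (n : ℕ) : MeasurableSpace Ω :=
  ⨆ j ∈ Finset.range (n + 1), MeasurableSpace.comap (Φ j) inferInstance

lemma measurable_history (Φ : ℕ → Ω → X) {j n : ℕ} (hj : j ≤ n) :
    Measurable[history Φ n] (Φ j) := by
  rw [measurable_iff_comap_le]
  exact le_iSup₂_of_le j (Finset.mem_range.2 (by omega)) le_rfl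

variable [mΩ : MeasurableSpace Ω]

namespace IsMarkovChain

variable {Pr : Measure Ω} {κ : Kernel X X} {μ : Measure X} {Φ : ℕ → Ω → X}

section

variable (hΦ : IsMarkovChain Pr κ μ Φ)
include hΦ

lemma history_le (n : ℕ) : history Φ n ≤ mΩ :=
  iSup₂_le fun j _ => (hΦ.measurable j).comap_le

lemma measurable_pair (n : ℕ) : Measurable fun ω => (Φ n ω, Φ (n + 1) ω) :=
  (hΦ.measurable n).prodMk (hΦ.measurable (n + 1))

variable [IsProbabilityMeasure Pr] [IsMarkovKernel κ]

/-- The joint law of two consecutive states, restricted to an event of the past. -/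
lemma map_restrict_pair {n : ℕ} {B : Set Ω} (hB : MeasurableSet[history Φ n] B) :
    (Pr.restrict B).map (fun ω => (Φ n ω, Φ (n + 1) ω)) = ((Pr.restrict B).map (Φ n)) ⊗ₘ κ := by
  refine Measure.ext_prod fun {s t} hs ht => ?_
  -- On a rectangle s × t the condition Φ_n ∈ s joins the past event, so the Markov property
  -- applies.
  have hs' : MeasurableSet[history Φ n] (Φ n ⁻¹' s) := measurable_history Φ le_rfl hs
  rw [Measure.map_apply (hΦ.measurable_pair n) (hs.prod ht),
    Measure.restrict_apply (hΦ.measurable_pair n (hs.prod ht)),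
    Measure.compProd_apply_prod hs ht,
    setLIntegral_map hs (κ.measurable_coe ht) (hΦ.measurable n),
    Measure.restrict_restrict (hΦ.measurable n hs), Set.inter_comm (Φ n ⁻¹' s) B,
    ← hΦ.markov n _ t (hB.inter hs') ht]
  congr 1
  ext ω
  simp only [Set.mem_inter_iff, Set.mem_preimage, Set.mem_prod]
  tauto

lemma map_pair (n : ℕ) :
    Pr.map (fun ω => (Φ n ω, Φ (n + 1) ω)) = (Pr.map (Φ n)) ⊗ₘ κ := by
  simpa using hΦ.map_restrict_pair (n := n) (B := Set.univ) MeasurableSet.univ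

lemma map_succ (n : ℕ) : Pr.map (Φ (n + 1)) = (Pr.map (Φ n)).bind κ := by
  have := Measure.isProbabilityMeasure_map (μ := Pr) (hΦ.measurable n).aemeasurable
  rw [← Measure.snd_compProd, ← hΦ.map_pair, Measure.snd,
    Measure.map_map measurable_snd (hΦ.measurable_pair n)]
  rfl

lemma setIntegral_pair {n : ℕ} {B : Set Ω} (hB : MeasurableSet[history Φ n] B) {u : X × X → ℝ}
    (hu : Measurable u) (hint : Integrable (fun ω => u (Φ n ω, Φ (n + 1) ω)) Pr) :
    ∫ ω in B, u (Φ n ω, Φ (n + 1) ω) ∂Pr = ∫ ω in B, ∫ y, u (Φ n ω, y) ∂(κ (Φ n ω)) ∂Pr := by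
  have h1 : ∫ ω in B, u (Φ n ω, Φ (n + 1) ω) ∂Pr
      = ∫ z, u z ∂((Pr.restrict B).map (fun ω => (Φ n ω, Φ (n + 1) ω))) :=
    (integral_map (hΦ.measurable_pair n).aemeasurable hu.aestronglyMeasurable).symm
  have h2 : Integrable u (((Pr.restrict B).map (Φ n)) ⊗ₘ κ) := by
    rw [← hΦ.map_restrict_pair hB, integrable_map_measure hu.aestronglyMeasurable
      (hΦ.measurable_pair n).aemeasurable]
    exact hint.restrict
  rw [h1, hΦ.map_restrict_pair hB, Measure.integral_compProd h2,
    integral_map (hΦ.measurable n).aemeasurable]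
  exact hu.stronglyMeasurable.integral_kernel_prod_right'.aestronglyMeasurable

lemma integral_pair (n : ℕ) {u : X × X → ℝ}
    (hu : Measurable u) (hint : Integrable (fun ω => u (Φ n ω, Φ (n + 1) ω)) Pr) :
    ∫ ω, u (Φ n ω, Φ (n + 1) ω) ∂Pr = ∫ ω, ∫ y, u (Φ n ω, y) ∂(κ (Φ n ω)) ∂Pr := by
  simpa using hΦ.setIntegral_pair (n := n) (B := Set.univ) MeasurableSet.univ hu hint

lemma lintegral_pair (n : ℕ) {u : X × X → ℝ≥0∞} (hu : Measurable u) :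
    ∫⁻ ω, u (Φ n ω, Φ (n + 1) ω) ∂Pr = ∫⁻ ω, ∫⁻ y, u (Φ n ω, y) ∂(κ (Φ n ω)) ∂Pr := by
  have := Measure.isProbabilityMeasure_map (μ := Pr) (hΦ.measurable n).aemeasurable
  rw [← lintegral_map hu (hΦ.measurable_pair n), hΦ.map_pair, Measure.lintegral_compProd hu,
    lintegral_map hu.lintegral_kernel_prod_right' (hΦ.measurable n)]

lemma ae_pair (n : ℕ) {q : X × X → Prop} (hq : MeasurableSet {z | q z})
    (h : ∀ x, ∀ᵐ y ∂(κ x), q (x, y)) : ∀ᵐ ω ∂Pr, q (Φ n ω, Φ (n + 1) ω) := by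
  have := Measure.isProbabilityMeasure_map (μ := Pr) (hΦ.measurable n).aemeasurable
  have h1 : ∀ᵐ z ∂(Pr.map fun ω => (Φ n ω, Φ (n + 1) ω)), q z := by
    rw [hΦ.map_pair, Measure.ae_compProd_iff hq]
    exact ae_of_all _ h
  exact (ae_map_iff (hΦ.measurable_pair n).aemeasurable hq).1 h1

/-- Martingale increments are orthogonal to the past. -/
lemma integral_mul_increment_eq_zero {n : ℕ} {u : X × X → ℝ} (hu : Measurable u)
    (hu0 : ∀ x, ∫ y, u (x, y) ∂(κ x) = 0)
    (huL : MemLp (fun ω => u (Φ n ω, Φ (n + 1) ω)) 2 Pr) {Z : Ω → ℝ}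
    (hZ : Measurable[history Φ n] Z) (hZL : MemLp Z 2 Pr) :
    ∫ ω, Z ω * u (Φ n ω, Φ (n + 1) ω) ∂Pr = 0 := by
  have hm := hΦ.history_le n
  set U : Ω → ℝ := fun ω => u (Φ n ω, Φ (n + 1) ω)
  have hUint : Integrable U Pr := huL.integrable one_le_two
  have hprod : Integrable (Z * U) Pr := hZL.integrable_mul huL
  have hcond : (0 : Ω → ℝ) =ᵐ[Pr] Pr[U | history Φ n] := by
    refine ae_eq_condExp_of_forall_setIntegral_eq hm hUint
      (fun _ _ _ => integrableOn_zero) (fun B hB _ => ?_)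
      (stronglyMeasurable_zero.aestronglyMeasurable)
    rw [hΦ.setIntegral_pair hB hu hUint]
    simp [hu0]
  have h1 : Pr[Z * U | history Φ n] =ᵐ[Pr] 0 := by
    refine (condExp_mul_of_stronglyMeasurable_left hZ.stronglyMeasurable hprod hUint).trans ?_
    filter_upwards [hcond] with ω hω
    simp [← hω]
  calc ∫ ω, Z ω * U ω ∂Pr = ∫ ω, (Pr[Z * U | history Φ n]) ω ∂Pr :=
        (integral_condExp hm (f := Z * U)).symm
    _ = ∫ ω, (0 : Ω → ℝ) ω ∂Pr := integral_congr_ae h1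
    _ = 0 := by simp

end

section drift

variable {K : Set X} {δ : ℝ} {m : ℕ} {ν : Measure X} {V : X → ℝ} {lam b : ℝ}
variable [IsProbabilityMeasure Pr] (hΦ : IsMarkovChain Pr κ μ Φ)
  (H : DriftMinorization κ K δ m ν V lam b) (hμ : Integrable V μ)
include hΦ H hμ

lemma integrable_V_law (n : ℕ) : Integrable V (Pr.map (Φ n)) := by
  have := H.markov
  induction n with
  | zero => rw [hΦ.initial]; exact hμ
  | succ n ih =>
    have := Measure.isProbabilityMeasure_map (μ := Pr) (hΦ.measurable n).aemeasurable
    rw [hΦ.map_succ]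
    exact H.integrable_V_bind ih

lemma integrable_V (n : ℕ) : Integrable (fun ω => V (Φ n ω)) Pr :=
  (integrable_map_measure H.V_measurable.aestronglyMeasurable
    (hΦ.measurable n).aemeasurable).1 (hΦ.integrable_V_law H hμ n)

lemma integrable_comp (n : ℕ) {φ : X → ℝ} (hφ : φ ∈ wBounded V) :
    Integrable (fun ω => φ (Φ n ω)) Pr :=
  (integrable_map_measure hφ.1.aestronglyMeasurable (hΦ.measurable n).aemeasurable).1
    (wBounded_integrable ⟨φ, hφ⟩ (hΦ.integrable_V_law H hμ n))

lemma integral_succ (n : ℕ) {φ : X → ℝ} (hφ : φ ∈ wBounded V) :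
    ∫ ω, φ (Φ (n + 1) ω) ∂Pr = ∫ ω, ∫ y, φ y ∂(κ (Φ n ω)) ∂Pr := by
  have := H.markov
  have := Measure.isProbabilityMeasure_map (μ := Pr) (hΦ.measurable n).aemeasurable
  rw [← integral_map (hΦ.measurable (n + 1)).aemeasurable hφ.1.aestronglyMeasurable,
    hΦ.map_succ, H.integral_bind (hΦ.integrable_V_law H hμ n) ⟨φ, hφ⟩,
    integral_map (hΦ.measurable n).aemeasurable (wBounded_measurable _).aestronglyMeasurable]
  rfl

/-- The constant b/(1 - lam) is the fixed point of c ↦ lam·c + b, so one drift step preserves the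
bound. -/
lemma integral_V_le (n : ℕ) : ∫ ω, V (Φ n ω) ∂Pr ≤ ∫ x, V x ∂μ + b / (1 - lam) := by
  have h1 : 0 < 1 - lam := by linarith [H.lam_lt_one]
  have hI : 0 ≤ ∫ x, V x ∂μ := integral_nonneg fun x => (H.V_pos x).le
  induction n with
  | zero =>
    rw [← integral_map (hΦ.measurable 0).aemeasurable H.V_measurable.aestronglyMeasurable,
      hΦ.initial]
    linarith [H.const_nonneg]
  | succ n ih =>
    rw [hΦ.integral_succ H hμ n (φ := V) H.wV.2]
    have hint := (hΦ.integrable_V H hμ n).const_mul lam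
    have h2 : ∫ ω, ∫ y, V y ∂(κ (Φ n ω)) ∂Pr ≤ ∫ ω, (lam * V (Φ n ω) + b) ∂Pr := by
      refine integral_mono (hΦ.integrable_comp H hμ n (H.integral_mem H.wV.2))
        (hint.add (integrable_const b)) fun ω => (H.integral_le _).trans ?_
      gcongr
      exact Set.indicator_le_self' (fun _ _ => H.b_pos.le) _
    rw [integral_add hint (integrable_const b), integral_const_mul] at h2
    simp only [integral_const, probReal_univ, one_smul] at h2
    have h3 : lam * (b / (1 - lam)) + b = b / (1 - lam) := by field_simp; ring
    have h4 := mul_le_mul_of_nonneg_left ih H.lam_pos.le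
    have h5 : lam * ∫ x, V x ∂μ ≤ ∫ x, V x ∂μ := mul_le_of_le_one_left hI H.lam_lt_one.le
    linarith

lemma memLp_comp (n : ℕ) {φ : X → ℝ} (hφ : φ ∈ wBounded fun x => √(V x)) :
    MemLp (fun ω => φ (Φ n ω)) 2 Pr := by
  obtain ⟨M, hM⟩ := hφ.2
  refine (memLp_two_iff_integrable_sq (hφ.1.comp (hΦ.measurable n)).aestronglyMeasurable).2 ?_
  refine ((hΦ.integrable_V H hμ n).const_mul (M ^ 2)).mono'
    ((hφ.1.comp (hΦ.measurable n)).pow_const 2).aestronglyMeasurable (ae_of_all _ fun ω => ?_)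
  rw [Real.norm_eq_abs, abs_pow]
  calc |φ (Φ n ω)| ^ 2 ≤ (M * √(V (Φ n ω))) ^ 2 := by gcongr; exact hM _
    _ = M ^ 2 * V (Φ n ω) := by rw [mul_pow, Real.sq_sqrt (H.V_pos _).le]

/-- Ergodic averages of expectations converge to the stationary expectation. -/
lemma tendsto_average {π : Measure X} [IsProbabilityMeasure π] (hπ : Kernel.Invariant κ π)
    {φ : X → ℝ} (hφ : φ ∈ wBounded V) :
    Tendsto (fun n : ℕ => (1 / (n : ℝ)) * ∑ k ∈ Finset.range n, ∫ ω, φ (Φ k ω) ∂Pr) atTop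
      (𝓝 (∫ x, φ x ∂π)) := by
  obtain ⟨g, hg, hP⟩ := H.exists_poisson hπ hφ
  obtain ⟨M, hM0, hM⟩ := wBounded_exists_nonneg_bound H.one_le_V ⟨g, hg⟩
  set c := ∫ x, φ x ∂π
  set G : ℕ → ℝ := fun k => ∫ ω, g (Φ k ω) ∂Pr
  -- The Poisson equation makes the sum telescope, leaving a boundary term bounded in n.
  have hstep (k : ℕ) : ∫ ω, φ (Φ k ω) ∂Pr = c + (G k - G (k + 1)) := by
    have h1 : ∫ ω, φ (Φ k ω) ∂Pr
        = ∫ ω, (c + (g (Φ k ω) - ∫ y, g y ∂(κ (Φ k ω)))) ∂Pr :=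
      integral_congr_ae (ae_of_all _ fun ω => by simp [hP])
    have hi1 := hΦ.integrable_comp H hμ k hg
    have hi2 := hΦ.integrable_comp H hμ k (H.integral_mem hg)
    have hi3 : Integrable (fun ω => g (Φ k ω) - ∫ y, g y ∂(κ (Φ k ω))) Pr := hi1.sub hi2
    rw [h1, integral_add (integrable_const c) hi3, integral_sub hi1 hi2,
      ← hΦ.integral_succ H hμ k hg]
    simp [G]
  have hsum (n : ℕ) : ∑ k ∈ Finset.range n, ∫ ω, φ (Φ k ω) ∂Pr = n * c + (G 0 - G n) := by
    simp_rw [hstep]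
    rw [Finset.sum_add_distrib, Finset.sum_range_sub']
    simp
  set B := ∫ x, V x ∂μ + b / (1 - lam)
  have hG (n : ℕ) : |G n| ≤ M * B := by
    rw [← Real.norm_eq_abs]
    refine (norm_integral_le_of_norm_le ((hΦ.integrable_V H hμ n).const_mul M)
      (ae_of_all _ fun ω => hM _)).trans ?_
    rw [integral_const_mul]
    exact mul_le_mul_of_nonneg_left (hΦ.integral_V_le H hμ n) hM0
  have hlim : Tendsto (fun n : ℕ => c + (1 / (n : ℝ)) * (G 0 - G n)) atTop (𝓝 (c + 0)) := by
    refine tendsto_const_nhds.add (squeeze_zero_norm (a := fun n : ℕ => (2 * (M * B)) / (n : ℝ))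
      (fun n => ?_) (tendsto_const_div_atTop_nhds_zero_nat _))
    rw [Real.norm_eq_abs, abs_mul, abs_of_nonneg (by positivity : (0 : ℝ) ≤ 1 / (n : ℝ)),
      one_div_mul_eq_div]
    gcongr
    linarith [abs_sub (G 0) (G n), hG 0, hG n]
  rw [add_zero] at hlim
  refine hlim.congr' ?_
  filter_upwards [eventually_gt_atTop 0] with n hn
  rw [hsum]
  field_simp

end drift

end IsMarkovChain
end

/-! ### The score martingale and the limit of the gradient estimator. -/

noncomputable section

variable {X Ω : Type*}

/-- The sum of the increments `u (Φ k, Φ (k + 1))` up to time `n`. -/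
def incrementSum (Φ : ℕ → Ω → X) (u : X × X → ℝ) (n : ℕ) (ω : Ω) : ℝ :=
  ∑ k ∈ Finset.range n, u (Φ k ω, Φ (k + 1) ω)

lemma incrementSum_succ (Φ : ℕ → Ω → X) (u : X × X → ℝ) (n : ℕ) (ω : Ω) :
    incrementSum Φ u (n + 1) ω = incrementSum Φ u n ω + u (Φ n ω, Φ (n + 1) ω) :=
  Finset.sum_range_succ _ _

lemma memLp_incrementSum [MeasurableSpace Ω] {Pr : Measure Ω} {Φ : ℕ → Ω → X} {u : X × X → ℝ}
    (huL : ∀ n, MemLp (fun ω => u (Φ n ω, Φ (n + 1) ω)) 2 Pr) (n : ℕ) :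
    MemLp (incrementSum Φ u n) 2 Pr :=
  memLp_finsetSum _ fun k _ => huL k

variable [MeasurableSpace X]

lemma measurable_incrementSum (Φ : ℕ → Ω → X) {u : X × X → ℝ} (hu : Measurable u) (n : ℕ) :
    Measurable[history Φ n] (incrementSum Φ u n) := by
  refine Finset.measurable_fun_sum _ fun k hk => ?_
  have hk' := Finset.mem_range.1 hk
  exact hu.comp ((measurable_history Φ (by omega)).prodMk (measurable_history Φ (by omega)))

variable [MeasurableSpace Ω]

namespace IsMarkovChain

variable {Pr : Measure Ω} [IsProbabilityMeasure Pr] {κ : Kernel X X} [IsMarkovKernel κ]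
  {μ : Measure X} {Φ : ℕ → Ω → X} (hΦ : IsMarkovChain Pr κ μ Φ) {u v : X × X → ℝ}

include hΦ

lemma integral_mul_incrementSum_eq_zero (hu : Measurable u)
    (hu0 : ∀ x, ∫ y, u (x, y) ∂(κ x) = 0)
    (huL : ∀ n, MemLp (fun ω => u (Φ n ω, Φ (n + 1) ω)) 2 Pr) {Z : X → ℝ} (hZ : Measurable Z)
    (hZL : MemLp (fun ω => Z (Φ 0 ω)) 2 Pr) (n : ℕ) :
    ∫ ω, Z (Φ 0 ω) * incrementSum Φ u n ω ∂Pr = 0 := by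
  induction n with
  | zero => simp [incrementSum]
  | succ n ih =>
    simp_rw [incrementSum_succ, mul_add]
    have h1 : Integrable (fun ω => Z (Φ 0 ω) * incrementSum Φ u n ω) Pr :=
      hZL.integrable_mul (memLp_incrementSum huL n)
    have h2 : Integrable (fun ω => Z (Φ 0 ω) * u (Φ n ω, Φ (n + 1) ω)) Pr :=
      hZL.integrable_mul (huL n)
    rw [integral_add h1 h2, ih, zero_add]
    exact hΦ.integral_mul_increment_eq_zero hu hu0 (huL n)
      (hZ.comp (measurable_history Φ (Nat.zero_le n))) hZL

/-- Orthogonality of martingale increments. -/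
lemma integral_incrementSum_mul (hu : Measurable u) (hu0 : ∀ x, ∫ y, u (x, y) ∂(κ x) = 0)
    (huL : ∀ n, MemLp (fun ω => u (Φ n ω, Φ (n + 1) ω)) 2 Pr)
    (hv : Measurable v) (hv0 : ∀ x, ∫ y, v (x, y) ∂(κ x) = 0)
    (hvL : ∀ n, MemLp (fun ω => v (Φ n ω, Φ (n + 1) ω)) 2 Pr) (n : ℕ) :
    ∫ ω, incrementSum Φ u n ω * incrementSum Φ v n ω ∂Pr
      = ∑ k ∈ Finset.range n, ∫ ω, u (Φ k ω, Φ (k + 1) ω) * v (Φ k ω, Φ (k + 1) ω) ∂Pr := by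
  induction n with
  | zero => simp [incrementSum]
  | succ n ih =>
    have hU := memLp_incrementSum (Φ := Φ) huL n
    have hV := memLp_incrementSum (Φ := Φ) hvL n
    set U := incrementSum Φ u n
    set W := incrementSum Φ v n
    set a : Ω → ℝ := fun ω => u (Φ n ω, Φ (n + 1) ω)
    set c : Ω → ℝ := fun ω => v (Φ n ω, Φ (n + 1) ω)
    have h1 : Integrable (fun ω => U ω * W ω) Pr := hU.integrable_mul hV
    have h2 : Integrable (fun ω => U ω * c ω) Pr := hU.integrable_mul (hvL n)
    have h3 : Integrable (fun ω => W ω * a ω) Pr := hV.integrable_mul (huL n)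
    have h4 : Integrable (fun ω => a ω * c ω) Pr := (huL n).integrable_mul (hvL n)
    have h12 : Integrable (fun ω => U ω * W ω + U ω * c ω) Pr := h1.add h2
    have h123 : Integrable (fun ω => U ω * W ω + U ω * c ω + W ω * a ω) Pr := h12.add h3
    have h0 (ω : Ω) : incrementSum Φ u (n + 1) ω * incrementSum Φ v (n + 1) ω
        = U ω * W ω + U ω * c ω + W ω * a ω + a ω * c ω := by
      rw [incrementSum_succ, incrementSum_succ]
      ring
    simp_rw [h0]
    rw [integral_add h123 h4, integral_add h12 h3, integral_add h1 h2, Finset.sum_range_succ, ← ih]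
    -- The sums up to n involve only Φ_0, …, Φ_n, so both cross terms with the next increment
    -- vanish.
    have e2 := hΦ.integral_mul_increment_eq_zero hv hv0 (hvL n) (measurable_incrementSum Φ hu n) hU
    have e3 := hΦ.integral_mul_increment_eq_zero hu hu0 (huL n) (measurable_incrementSum Φ hv n) hV
    rw [e2, e3, add_zero, add_zero]

end IsMarkovChain

/-- The partial derivative of a product of functions that equal `1` at the base point. -/
lemma partialDeriv_prod_of_eq_one {d : ℕ} (i : Fin d) (θ : Fin d → ℝ) {ι : Type*} (s : Finset ι)
    {F : ι → (Fin d → ℝ) → ℝ} (hF : ∀ j, HasGradientAt (F j) θ) (h1 : ∀ j ∈ s, F j θ = 1) :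
    partialDeriv i (fun θ => ∏ j ∈ s, F j θ) θ = ∑ j ∈ s, partialDeriv i (F j) θ := by
  classical
  have h := HasDerivAt.fun_finsetProd (u := s) (f := fun j (t : ℝ) => F j (θ + t • Pi.single i 1))
    (x := 0) (fun j _ => (hF j i).hasLineDerivAt)
  have h2 : HasLineDerivAt ℝ (fun θ => ∏ j ∈ s, F j θ) _ θ (Pi.single i 1) := h
  rw [partialDeriv, h2.lineDeriv]
  refine Finset.sum_congr rfl fun j _ => ?_
  rw [Finset.prod_eq_one]
  · simp [partialDeriv]
  · intro k hk
    simpa using h1 k (Finset.mem_of_mem_erase hk)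

/-- The score function, as a function on pairs of states. -/
def score {d : ℕ} (p : (Fin d → ℝ) → X → X → ℝ) (θ₀ : Fin d → ℝ) (i : Fin d) (z : X × X) : ℝ :=
  partialDeriv i (fun θ => p θ z.1 z.2) θ₀

namespace StandingAssumption

variable {d : ℕ} {Θ : Set (Fin d → ℝ)} {P : (Fin d → ℝ) → Kernel X X}
  {p : (Fin d → ℝ) → X → X → ℝ} {θ₀ : Fin d → ℝ} {ε : ℝ} {K : Set X} {δ : ℝ} {m : ℕ}
  {ν : Measure X} {V : X → ℝ} {lam b : ℝ} {f : X → ℝ}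
  (hA : StandingAssumption Θ P p θ₀ ε K δ m ν V lam b f)
  {Pr : Measure Ω} [IsProbabilityMeasure Pr] {μ : Measure X} {Φ : ℕ → Ω → X}
  (hΦ : IsMarkovChain Pr (P θ₀) μ Φ) (hμ : Integrable V μ)

include hA

/-- Both `p θ₀ x` and 1 are densities of `P θ₀ x` with respect to itself, so they agree almost
everywhere. -/
lemma density_eq_one (x : X) : ∀ᵐ y ∂(P θ₀ x), p θ₀ x y = 1 := by
  have := hA.markov θ₀ hA.mem
  have hm : Measurable fun y => ENNReal.ofReal (p θ₀ x y) :=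
    ((hA.density_measurable θ₀ hA.mem_box).comp measurable_prodMk_left).ennreal_ofReal
  have h1 : (P θ₀ x).withDensity (fun y => ENNReal.ofReal (p θ₀ x y))
      = (P θ₀ x).withDensity 1 := by
    rw [withDensity_one]
    exact (hA.density θ₀ hA.mem_box x).symm
  filter_upwards [(withDensity_eq_iff_of_sigmaFinite hm.aemeasurable aemeasurable_one).1 h1]
    with y hy
  exact ENNReal.ofReal_eq_one.1 hy

include hΦ

/-- The gradient of the likelihood ratio is the sum of the scores. -/
lemma grad_likelihoodRatio (i : Fin d) (n : ℕ) : ∀ᵐ ω ∂Pr,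
    grad (fun θ => likelihoodRatio p Φ n θ ω) θ₀ i = incrementSum Φ (score p θ₀ i) n ω := by
  have := hA.markov θ₀ hA.mem
  have h1 : ∀ᵐ ω ∂Pr, ∀ k, p θ₀ (Φ k ω) (Φ (k + 1) ω) = 1 :=
    ae_all_iff.2 fun k => hΦ.ae_pair k (q := fun z => p θ₀ z.1 z.2 = 1)
      (hA.density_measurable θ₀ hA.mem_box (measurableSet_singleton 1)) hA.density_eq_one
  filter_upwards [h1] with ω hω
  exact partialDeriv_prod_of_eq_one i θ₀ (Finset.range n)
    (F := fun j θ => p θ (Φ j ω) (Φ (j + 1) ω))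
    (fun j => hA.density_differentiable _ _) (fun j _ => hω j)

include hμ

/-- Conditioning on Φ_k gives g_ii(Φ_k) ≤ M V(Φ_k), whose mean is bounded in k. -/
lemma exists_lintegral_score_sq_le (i : Fin d) : ∃ C, 0 ≤ C ∧ ∀ k,
    ∫⁻ ω, ENNReal.ofReal (score p θ₀ i (Φ k ω, Φ (k + 1) ω) ^ 2) ∂Pr ≤ ENNReal.ofReal C := by
  have := hA.markov θ₀ hA.mem
  have H := hA.driftMinorization hA.mem_box
  obtain ⟨M, hM0, hM⟩ := exists_bound_of_wnorm_lt_top hA.one_le_V (hA.fisher_bounded i)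
  have hB : 0 ≤ ∫ x, V x ∂μ + max b 1 / (1 - lam) :=
    add_nonneg (integral_nonneg fun x => (H.V_pos x).le) H.const_nonneg
  refine ⟨M * (∫ x, V x ∂μ + max b 1 / (1 - lam)), by positivity, fun k => ?_⟩
  rw [hΦ.lintegral_pair k (u := fun z => ENNReal.ofReal (score p θ₀ i z ^ 2))
    ((hA.measurable_score i).pow_const 2).ennreal_ofReal]
  calc ∫⁻ ω, ∫⁻ y, ENNReal.ofReal (score p θ₀ i (Φ k ω, y) ^ 2) ∂(P θ₀ (Φ k ω)) ∂Pr
      ≤ ∫⁻ ω, ENNReal.ofReal (M * V (Φ k ω)) ∂Pr := lintegral_mono fun ω => hM (Φ k ω)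
    _ = ENNReal.ofReal (∫ ω, M * V (Φ k ω) ∂Pr) :=
        (ofReal_integral_eq_lintegral_ofReal ((hΦ.integrable_V H hμ k).const_mul M)
          (ae_of_all _ fun ω => mul_nonneg hM0 (H.V_pos _).le)).symm
    _ ≤ _ := by
        refine ENNReal.ofReal_le_ofReal ?_
        rw [integral_const_mul]
        exact mul_le_mul_of_nonneg_left (hΦ.integral_V_le H hμ k) hM0

lemma memLp_score (i : Fin d) (k : ℕ) :
    MemLp (fun ω => score p θ₀ i (Φ k ω, Φ (k + 1) ω)) 2 Pr := by
  have hm : Measurable fun ω => score p θ₀ i (Φ k ω, Φ (k + 1) ω) :=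
    (hA.measurable_score i).comp (hΦ.measurable_pair k)
  obtain ⟨C, _, hC⟩ := hA.exists_lintegral_score_sq_le hΦ hμ i
  refine (memLp_two_iff_integrable_sq hm.aestronglyMeasurable).2
    ⟨(hm.pow_const 2).aestronglyMeasurable, ?_⟩
  rw [hasFiniteIntegral_iff_ofReal (ae_of_all _ fun ω => sq_nonneg _)]
  exact (hC k).trans_lt ENNReal.ofReal_lt_top

lemma exists_integral_score_sq_le (i : Fin d) : ∃ C, 0 ≤ C ∧ ∀ k,
    ∫ ω, score p θ₀ i (Φ k ω, Φ (k + 1) ω) * score p θ₀ i (Φ k ω, Φ (k + 1) ω) ∂Pr ≤ C := by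
  obtain ⟨C, hC0, hC⟩ := hA.exists_lintegral_score_sq_le hΦ hμ i
  refine ⟨C, hC0, fun k => ?_⟩
  have hm : Measurable fun ω => score p θ₀ i (Φ k ω, Φ (k + 1) ω) :=
    (hA.measurable_score i).comp (hΦ.measurable_pair k)
  simp_rw [← pow_two]
  rw [integral_eq_lintegral_of_nonneg_ae (ae_of_all _ fun ω => sq_nonneg _)
    (hm.pow_const 2).aestronglyMeasurable]
  exact ENNReal.toReal_le_of_le_ofReal hC0 (hC k)

lemma memLp_timeAverage (n : ℕ) : MemLp (timeAverage f Φ n) 2 Pr :=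
  (memLp_finsetSum _ fun k _ =>
    hΦ.memLp_comp (hA.driftMinorization hA.mem_box) hμ k hA.f_mem).const_mul _

lemma integrable_timeAverage_mul_grad (n : ℕ) (i : Fin d) : Integrable (fun ω =>
    timeAverage f Φ n ω * grad (fun θ => likelihoodRatio p Φ n θ ω) θ₀ i) Pr := by
  have h1 := (hA.memLp_timeAverage hΦ hμ n).integrable_mul
    (memLp_incrementSum (hA.memLp_score hΦ hμ i) n)
  refine h1.congr ?_
  filter_upwards [hA.grad_likelihoodRatio hΦ i n] with ω hω
  rw [Pi.mul_apply, hω]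

/-- Convergence of the likelihood ratio gradient estimator. -/
theorem tendsto_integral_timeAverage_mul_score [Nonempty X] (i : Fin d) {g : X → ℝ}
    (hg : g ∈ wBounded fun x => √(V x))
    (hP : ∀ x, g x - ∫ y, g y ∂(P θ₀ x) = f x - steadyState P f θ₀) :
    Tendsto (fun n : ℕ => ∫ ω, timeAverage f Φ n ω * incrementSum Φ (score p θ₀ i) n ω ∂Pr) atTop
      (𝓝 (steadyState P (derivKernel P p θ₀ i g) θ₀)) := by
  have := hA.markov θ₀ hA.mem
  have H := hA.driftMinorization hA.mem_box
  have hst := hA.stationary_spec hA.mem_box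
  have := hst.1
  have hgV : g ∈ wBounded V := mem_wBounded_of_sqrt hA.one_le_V hg
  have hPg : (fun x => ∫ y, g y ∂(P θ₀ x)) ∈ wBounded fun x => √(V x) := H.sqrt.integral_mem hg
  set c := steadyState P f θ₀
  set s := score p θ₀ i
  set D : X × X → ℝ := fun z => g z.2 - ∫ y, g y ∂(P θ₀ z.1) with hD_def
  have hs : Measurable s := hA.measurable_score i
  have hs0 (x : X) : ∫ y, s (x, y) ∂(P θ₀ x) = 0 := hA.integral_score_eq_zero i x
  have hsL := hA.memLp_score hΦ hμ i
  have hD : Measurable D := (hg.1.comp measurable_snd).sub (hPg.1.comp measurable_fst)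
  have hgint (x : X) : Integrable g (P θ₀ x) :=
    wBounded_integrable ⟨g, hgV⟩ (H.integrable_V_kernel x)
  have hD0 (x : X) : ∫ y, D (x, y) ∂(P θ₀ x) = 0 := by
    simp only [hD_def]
    rw [integral_sub (hgint x) (integrable_const _)]
    simp
  have hgL (k : ℕ) : MemLp (fun ω => g (Φ k ω)) 2 Pr := hΦ.memLp_comp H hμ k hg
  have hDL (k : ℕ) : MemLp (fun ω => D (Φ k ω, Φ (k + 1) ω)) 2 Pr :=
    (hgL (k + 1)).sub (hΦ.memLp_comp H hμ k hPg)
  have hML (n : ℕ) := memLp_incrementSum (Φ := Φ) hsL n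
  have hNL (n : ℕ) := memLp_incrementSum (Φ := Φ) hDL n
  have hsint (x : X) : Integrable (fun y => s (x, y)) (P θ₀ x) := by
    refine (hA.deriv_integrable i x).mono
      (hs.comp measurable_prodMk_left).aestronglyMeasurable (ae_of_all _ fun y => ?_)
    rw [norm_mul]
    refine le_mul_of_one_le_left (norm_nonneg _) ?_
    rw [Real.norm_of_nonneg (H.V_pos y).le]
    exact hA.one_le_V y
  have hgsint (x : X) : Integrable (fun y => g y * s (x, y)) (P θ₀ x) := by
    obtain ⟨M, hM0, hM⟩ := wBounded_exists_nonneg_bound hA.one_le_V ⟨g, hgV⟩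
    refine ((hA.deriv_integrable i x).const_mul M).mono
      (hg.1.mul (hs.comp measurable_prodMk_left)).aestronglyMeasurable (ae_of_all _ fun y => ?_)
    rw [norm_mul, norm_mul, norm_mul, ← mul_assoc, Real.norm_of_nonneg hM0,
      Real.norm_of_nonneg (H.V_pos y).le]
    exact mul_le_mul_of_nonneg_right (hM y) (norm_nonneg _)
  -- Conditionally on Φ_k the term Pg(Φ_k) is constant and the score has mean zero, so only
  -- P^(i)g(Φ_k) remains.
  have hcross (k : ℕ) : ∫ ω, s (Φ k ω, Φ (k + 1) ω) * D (Φ k ω, Φ (k + 1) ω) ∂Pr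
      = ∫ ω, derivKernel P p θ₀ i g (Φ k ω) ∂Pr := by
    rw [hΦ.integral_pair k (u := fun z => s z * D z) (hs.mul hD)
      ((hsL k).integrable_mul (hDL k))]
    refine integral_congr_ae (ae_of_all _ fun ω => ?_)
    have h1 (y : X) : s (Φ k ω, y) * D (Φ k ω, y)
        = g y * s (Φ k ω, y) - (∫ z, g z ∂(P θ₀ (Φ k ω))) * s (Φ k ω, y) := by
      simp only [hD_def]
      ring
    simp_rw [h1]
    rw [integral_sub (hgsint _) ((hsint _).const_mul _), integral_const_mul, hs0, mul_zero,
      sub_zero]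
    rfl
  have hdecomp (n : ℕ) (ω : Ω) : ∑ j ∈ Finset.range n, f (Φ j ω)
      = n * c + (g (Φ 0 ω) - g (Φ n ω)) + incrementSum Φ D n ω := by
    induction n with
    | zero => simp [incrementSum]
    | succ n ih =>
      rw [Finset.sum_range_succ, ih, incrementSum_succ]
      have := hP (Φ n ω)
      simp only [hD_def]
      push_cast
      linarith
  have hexp (n : ℕ) :
      ∫ ω, timeAverage f Φ n ω * incrementSum Φ s n ω ∂Pr
        = (1 / (n : ℝ)) * ∑ k ∈ Finset.range n, ∫ ω, derivKernel P p θ₀ i g (Φ k ω) ∂Pr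
          - (1 / (n : ℝ)) * ∫ ω, g (Φ n ω) * incrementSum Φ s n ω ∂Pr := by
    have i1 : Integrable (fun ω => incrementSum Φ s n ω) Pr := (hML n).integrable one_le_two
    have i2 : Integrable (fun ω => g (Φ 0 ω) * incrementSum Φ s n ω) Pr :=
      (hgL 0).integrable_mul (hML n)
    have i3 : Integrable (fun ω => g (Φ n ω) * incrementSum Φ s n ω) Pr :=
      (hgL n).integrable_mul (hML n)
    have i4 : Integrable (fun ω => incrementSum Φ s n ω * incrementSum Φ D n ω) Pr :=
      (hML n).integrable_mul (hNL n)
    have hpt (ω : Ω) : timeAverage f Φ n ω * incrementSum Φ s n ω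
        = (1 / (n : ℝ)) * (n * c * incrementSum Φ s n ω + g (Φ 0 ω) * incrementSum Φ s n ω
            - g (Φ n ω) * incrementSum Φ s n ω
            + incrementSum Φ s n ω * incrementSum Φ D n ω) := by
      rw [timeAverage, hdecomp]
      ring
    have z1 : ∫ ω, incrementSum Φ s n ω ∂Pr = 0 := by
      simpa using hΦ.integral_mul_incrementSum_eq_zero hs hs0 hsL (Z := fun _ => 1)
        measurable_const (memLp_const 1) n
    have z2 : ∫ ω, g (Φ 0 ω) * incrementSum Φ s n ω ∂Pr = 0 :=
      hΦ.integral_mul_incrementSum_eq_zero hs hs0 hsL hg.1 (hgL 0) n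
    have z4 := hΦ.integral_incrementSum_mul hs hs0 hsL hD hD0 hDL n
    simp_rw [hcross] at z4
    have j1 : Integrable (fun ω => n * c * incrementSum Φ s n ω) Pr := i1.const_mul _
    have j2 : Integrable (fun ω => n * c * incrementSum Φ s n ω
        + g (Φ 0 ω) * incrementSum Φ s n ω) Pr := j1.add i2
    have j3 : Integrable (fun ω => n * c * incrementSum Φ s n ω
        + g (Φ 0 ω) * incrementSum Φ s n ω - g (Φ n ω) * incrementSum Φ s n ω) Pr := j2.sub i3
    simp_rw [hpt]
    rw [integral_const_mul, integral_add j3 i4, integral_sub j2 i3, integral_add j1 i2,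
      integral_const_mul, z1, z2, z4]
    ring
  obtain ⟨C, hC0, hC⟩ := hA.exists_integral_score_sq_le hΦ hμ i
  obtain ⟨M, hM⟩ := hg.2
  set B := ∫ x, V x ∂μ + max b 1 / (1 - lam)
  have hvar (n : ℕ) : ∫ ω, incrementSum Φ s n ω * incrementSum Φ s n ω ∂Pr ≤ n * C := by
    rw [hΦ.integral_incrementSum_mul hs hs0 hsL hs hs0 hsL n]
    calc _ ≤ ∑ _k ∈ Finset.range n, C := Finset.sum_le_sum fun k _ => hC k
      _ = n * C := by simp
  have hg2 (n : ℕ) : ∫ ω, g (Φ n ω) * g (Φ n ω) ∂Pr ≤ M ^ 2 * B := by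
    calc ∫ ω, g (Φ n ω) * g (Φ n ω) ∂Pr ≤ ∫ ω, M ^ 2 * V (Φ n ω) ∂Pr := by
          refine integral_mono ((hgL n).integrable_mul (hgL n))
            ((hΦ.integrable_V H hμ n).const_mul _) fun ω => ?_
          calc g (Φ n ω) * g (Φ n ω) = |g (Φ n ω)| ^ 2 := by rw [sq_abs, pow_two]
            _ ≤ (M * √(V (Φ n ω))) ^ 2 := by gcongr; exact hM _
            _ = M ^ 2 * V (Φ n ω) := by rw [mul_pow, Real.sq_sqrt (H.V_pos _).le]
      _ ≤ M ^ 2 * B := by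
          rw [integral_const_mul]
          exact mul_le_mul_of_nonneg_left (hΦ.integral_V_le H hμ n) (sq_nonneg M)
  have hrem : Tendsto (fun n : ℕ => (1 / (n : ℝ)) * ∫ ω, g (Φ n ω) * incrementSum Φ s n ω ∂Pr)
      atTop (𝓝 0) := by
    have hsqrt : Tendsto (fun n : ℕ => (M ^ 2 * B + C) / √(n : ℝ)) atTop (𝓝 0) :=
      tendsto_const_nhds.div_atTop (Real.tendsto_sqrt_atTop.comp tendsto_natCast_atTop_atTop)
    refine squeeze_zero_norm' ?_ hsqrt
    filter_upwards [eventually_gt_atTop 0] with n hn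
    have hn' : (0 : ℝ) < n := Nat.cast_pos.2 hn
    have hq : 0 < √(n : ℝ) := Real.sqrt_pos.2 hn'
    have k1 : Integrable (fun ω => √(n : ℝ) * (g (Φ n ω) * g (Φ n ω))) Pr :=
      ((hgL n).integrable_mul (hgL n)).const_mul _
    have k2 : Integrable (fun ω => (√(n : ℝ))⁻¹ *
        (incrementSum Φ s n ω * incrementSum Φ s n ω)) Pr :=
      ((hML n).integrable_mul (hML n)).const_mul _
    -- The weighted inequality |gM| ≤ √n g² + M²/√n balances E g² = O(1) against E M² = O(n); both
    -- terms are O(√n).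
    have h1 : ‖∫ ω, g (Φ n ω) * incrementSum Φ s n ω ∂Pr‖
        ≤ √(n : ℝ) * (M ^ 2 * B) + (√(n : ℝ))⁻¹ * (n * C) := by
      refine (norm_integral_le_of_norm_le (k1.add k2) (ae_of_all _ fun ω => ?_)).trans ?_
      · rw [Real.norm_eq_abs, abs_mul]
        simp only [Pi.add_apply]
        rw [← abs_mul_abs_self (g (Φ n ω)), ← abs_mul_abs_self (incrementSum Φ s n ω)]
        set A := |g (Φ n ω)|
        set E := |incrementSum Φ s n ω|
        have e1 : √(n : ℝ) * (A * A) + (√(n : ℝ))⁻¹ * (E * E)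
            = ((√(n : ℝ) * A) ^ 2 + E ^ 2) / √(n : ℝ) := by field_simp
        rw [e1, le_div_iff₀ hq]
        nlinarith [sq_nonneg (√(n : ℝ) * A - E), sq_nonneg (√(n : ℝ) * A), sq_nonneg E]
      · rw [integral_add' k1 k2, integral_const_mul, integral_const_mul]
        gcongr
        · exact hg2 n
        · exact hvar n
    rw [norm_mul, Real.norm_of_nonneg (by positivity : (0 : ℝ) ≤ 1 / n)]
    calc (1 / (n : ℝ)) * ‖∫ ω, g (Φ n ω) * incrementSum Φ s n ω ∂Pr‖
        ≤ (1 / (n : ℝ)) * (√(n : ℝ) * (M ^ 2 * B) + (√(n : ℝ))⁻¹ * (n * C)) := by gcongr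
      _ = (M ^ 2 * B + C) / √(n : ℝ) := by
          field_simp
          rw [Real.sq_sqrt hn'.le]
          ring
  have hmain := hΦ.tendsto_average H hμ hst.2 (hA.derivKernel_mem i hgV)
  have hlim := hmain.sub hrem
  rw [sub_zero] at hlim
  exact hlim.congr fun n => (hexp n).symm

end StandingAssumption
end

end LRGradient

/-! ### The theorem. -/

open LRGradient in
theorem theoremT {X Ω : Type*} [MeasurableSpace X] [MeasurableSpace.CountablyGenerated X]
    [MeasurableSpace Ω] {d : ℕ}
    (Θ : Set (Fin d → ℝ)) (P : (Fin d → ℝ) → Kernel X X) (p : (Fin d → ℝ) → X → X → ℝ)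
    (θ₀ : Fin d → ℝ) (ε : ℝ) (K : Set X) (δ : ℝ) (m : ℕ) (ν : Measure X)
    (V : X → ℝ) (lam b : ℝ) (f : X → ℝ)
    (hA : StandingAssumption Θ P p θ₀ ε K δ m ν V lam b f)
    (Pr : Measure Ω) [IsProbabilityMeasure Pr] (μ : Measure X) (Φ : ℕ → Ω → X)
    (hΦ : IsMarkovChain Pr (P θ₀) μ Φ) (hμ : Integrable V μ) :
    -- `π(θ)` and `α(θ) = π(θ) f` are well defined near `θ₀`
    (∀ θ ∈ box Θ θ₀ ε, (∃! π : Measure X, IsStationary (P θ) π) ∧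
      Integrable f (stationary (P θ))) ∧
    -- the gradient of `α` exists at `θ₀`
    HasGradientAt (steadyState P f) θ₀ ∧
    -- the finite-horizon expectations are well defined and converge to the gradient
    (∀ (n : ℕ) (i : Fin d), Integrable (fun ω =>
      timeAverage f Φ n ω * grad (fun θ => likelihoodRatio p Φ n θ ω) θ₀ i) Pr) ∧
    Tendsto (fun (n : ℕ) (i : Fin d) => ∫ ω,
        timeAverage f Φ n ω * grad (fun θ => likelihoodRatio p Φ n θ ω) θ₀ i ∂Pr)
      atTop (𝓝 (grad (steadyState P f) θ₀)) := by
  have : Nonempty X := (nonempty_of_isProbabilityMeasure Pr).map (Φ 0)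
  have hf : f ∈ wBounded V := mem_wBounded_of_sqrt hA.one_le_V hA.f_mem
  have hst := hA.stationary_spec hA.mem_box
  have := hst.1
  -- One g serves both halves: its √V bound gives the L² estimates, and the weaker V bound gives the
  -- derivative.
  obtain ⟨g, hg, hP⟩ := (hA.driftMinorization hA.mem_box).sqrt.exists_poisson hst.2 hA.f_mem
  have hderiv (i : Fin d) := hA.hasLineDerivAt_steadyState i hf
    (mem_wBounded_of_sqrt hA.one_le_V hg) hP
  refine ⟨fun θ hθ => ⟨(hA.driftMinorization hθ).existsUnique_stationary,
    hA.integrable_stationary hθ hf⟩, fun i => (hderiv i).lineDifferentiableAt,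
    hA.integrable_timeAverage_mul_grad hΦ hμ, tendsto_pi_nhds.2 fun i => ?_⟩
  have hgrad : grad (steadyState P f) θ₀ i = steadyState P (derivKernel P p θ₀ i g) θ₀ :=
    (hderiv i).lineDeriv
  rw [hgrad]
  refine (hA.tendsto_integral_timeAverage_mul_score hΦ hμ i hg hP).congr fun n => ?_
  refine integral_congr_ae ?_
  filter_upwards [hA.grad_likelihoodRatio hΦ i n] with ω hω
  rw [hω]
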